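/- Let $d\ge 1$ and let $\nu$ be the Haar probability measure on $O(d)$, or let $d\ge 2$ and let $\nu$ be the Haar probability measure on $SO(d)$, regarded as the law of a random real $d\times d$ matrix. A random real $d\times d$ matrix $B$ with rows $r_1,\dots,r_d$ has \emph{$\sigma$-simple structure} if (1) its entries have finite moments of order $2+\varepsilon$ for some $\varepsilon>0$; (2) for all $j\ne k$ the matrix $E[r_j^\top r_k]$ is antisymmetric, with operator norm at most some constant $C>0$; (3) $E[r_j^\top r_j]=\sigma^2\,\mathrm{Id}_d$ for all $j$. The spectral distribution of a real symmetric $N\times N$ matrix is the probability measure that puts mass $1/N$ at each eigenvalue, counted with multiplicity. The semicircle law has density $\frac1{2\pi}\sqrt{4-x^2}$ on $[-2,2]$; its scaling by $c>0$ is the law of $cX$, where $X$ follows the semicircle law. (i) If $B$ has law $\nu$, then $E[B]=0$ and $B$ has $\sigma$-simple structure with $\sigma=1/\sqrt d$. (ii) For each $n$ let $N=nd$ and let $M_n$ be a random real symmetric $N\times N$ matrix, viewed as an $n\times n$ block matrix with $d\times d$ blocks, whose blocks strictly above the block diagonal are i.i.d. with law $\nu$. Let $DM_n$ be its block diagonal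 part, and suppose that $\|DM_n\|_{\mathrm{op}}/\sqrt N\to 0$ in probability as $n\to\infty$ ($d$ fixed; the $M_n$ are defined on a common probability space). Then the spectral distribution of $M_n/\sqrt N$ converges weakly in probability to the semicircle law scaled by $d^{-1/2}$; that is, for every bounded continuous $f:\mathbb R\to\mathbb R$, the integral of $f$ against the spectral distribution converges in probability to its integral against this law. If moreover, for every $n$, $M_{n+1}$ is constructed by bordering $M_n$ with a last block row and block column such that the last block column of $M_{n+1}$ (its diagonal block included) is independent of $M_n$, then almost surely the spectral distribution of $M_n/\sqrt N$ converges weakly to the semicircle law scaled by $d^{-1/2}$. -/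

import Mathlib

open MeasureTheory ProbabilityTheory Filter Topology

/-- Matrices carry the product sigma-algebra of their entries. -/
instance Matrix.instMeasurableSpaceEntries {m n α : Type*} [MeasurableSpace α] :
    MeasurableSpace (Matrix m n α) :=
  inferInstanceAs (MeasurableSpace (m → n → α))

instance Matrix.instBorelSpaceEntries {m n : Type*} [Countable m] [Countable n] :
    BorelSpace (Matrix m n ℝ) :=
  inferInstanceAs (BorelSpace (m → n → ℝ))

namespace HaarBlocks

section HaarMeasures

instance instCompactSpaceO (d : ℕ) : CompactSpace (Matrix.orthogonalGroup (Fin d) ℝ) := by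
  refine isCompact_iff_compactSpace.1 ?_
  have hK : IsCompact (Set.pi Set.univ fun _ : Fin d =>
      Set.pi Set.univ fun _ : Fin d => Set.Icc (-1 : ℝ) 1) :=
    isCompact_univ_pi fun _ => isCompact_univ_pi fun _ => isCompact_Icc
  have hc : IsClosed {A : Matrix (Fin d) (Fin d) ℝ | A * A.transpose = 1} :=
    isClosed_eq (by fun_prop) continuous_const
  have hs : ((Matrix.orthogonalGroup (Fin d) ℝ : Submonoid (Matrix (Fin d) (Fin d) ℝ)) :
      Set (Matrix (Fin d) (Fin d) ℝ)) = {A | A * A.transpose = 1} := by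
    ext A
    exact Matrix.mem_orthogonalGroup_iff (Fin d) ℝ
  rw [hs]
  refine hK.of_isClosed_subset hc fun A hA i _ j _ => ?_
  have hA' : A ∈ Matrix.unitaryGroup (Fin d) ℝ :=
    (Matrix.mem_orthogonalGroup_iff (Fin d) ℝ).2 hA
  have := entry_norm_bound_of_unitary hA' i j
  rw [Real.norm_eq_abs] at this
  exact abs_le.1 this

instance instCompactSpaceSO (d : ℕ) :
    CompactSpace (Matrix.specialOrthogonalGroup (Fin d) ℝ) := by
  refine isCompact_iff_compactSpace.1 ?_
  have hO : IsCompact ((Matrix.orthogonalGroup (Fin d) ℝ :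
      Submonoid (Matrix (Fin d) (Fin d) ℝ)) : Set (Matrix (Fin d) (Fin d) ℝ)) :=
    isCompact_iff_compactSpace.2 (instCompactSpaceO d)
  have hc : IsClosed {A : Matrix (Fin d) (Fin d) ℝ | A.det = 1} :=
    isClosed_eq (by fun_prop) continuous_const
  have hs : ((Matrix.specialOrthogonalGroup (Fin d) ℝ :
      Submonoid (Matrix (Fin d) (Fin d) ℝ)) : Set (Matrix (Fin d) (Fin d) ℝ)) =
      ((Matrix.orthogonalGroup (Fin d) ℝ : Submonoid (Matrix (Fin d) (Fin d) ℝ)) :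
        Set (Matrix (Fin d) (Fin d) ℝ)) ∩ {A : Matrix (Fin d) (Fin d) ℝ | A.det = 1} := by
    ext A
    exact Matrix.mem_specialOrthogonalGroup_iff
  rw [hs]
  exact hO.inter_right hc

instance instIsTopologicalGroupSO (d : ℕ) :
    IsTopologicalGroup (Matrix.specialOrthogonalGroup (Fin d) ℝ) where
  continuous_inv := by
    refine continuous_induced_rng.2 ?_
    change Continuous fun A : Matrix.specialOrthogonalGroup (Fin d) ℝ =>
      (A : Matrix (Fin d) (Fin d) ℝ).transpose
    fun_prop

/-- The Haar probability measure of `O(d)`, as the law of a random `d × d` matrix. -/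
noncomputable def haarO (d : ℕ) : Measure (Matrix (Fin d) (Fin d) ℝ) :=
  (Measure.haarMeasure
    (⊤ : TopologicalSpace.PositiveCompacts (Matrix.orthogonalGroup (Fin d) ℝ))).map
    (Subtype.val : Matrix.orthogonalGroup (Fin d) ℝ → Matrix (Fin d) (Fin d) ℝ)

/-- The Haar probability measure of `SO(d)`, as the law of a random `d × d` matrix. -/
noncomputable def haarSO (d : ℕ) : Measure (Matrix (Fin d) (Fin d) ℝ) :=
  (Measure.haarMeasure
    (⊤ : TopologicalSpace.PositiveCompacts (Matrix.specialOrthogonalGroup (Fin d) ℝ))).map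
    (Subtype.val : Matrix.specialOrthogonalGroup (Fin d) ℝ → Matrix (Fin d) (Fin d) ℝ)

end HaarMeasures

/-- The operator norm of a real square matrix (its largest singular value). -/
noncomputable def opNorm {ι : Type*} [Fintype ι] [DecidableEq ι] (A : Matrix ι ι ℝ) : ℝ :=
  ‖Matrix.toEuclideanCLM (𝕜 := ℝ) A‖

/-- The matrix `E[r_jᵀ r_k]`, where `r_j` and `r_k` are the `j`-th and `k`-th rows (as row
vectors) of the random matrix `B`. -/
noncomputable def rowCross {Ω : Type*} [MeasurableSpace Ω] {d : ℕ}
    (B : Ω → Matrix (Fin d) (Fin d) ℝ) (P : Measure Ω) (j k : Fin d) :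
    Matrix (Fin d) (Fin d) ℝ :=
  Matrix.of fun a b => ∫ ω, B ω j a * B ω k b ∂P

/-- The random matrix `B` has `σ`-simple structure. -/
structure HasSimpleStructure {Ω : Type*} [MeasurableSpace Ω] {d : ℕ} (σ : ℝ)
    (B : Ω → Matrix (Fin d) (Fin d) ℝ) (P : Measure Ω) : Prop where
  moments : ∃ ε : ℝ, 0 < ε ∧ ∀ i j, MemLp (fun ω => B ω i j) (ENNReal.ofReal (2 + ε)) P
  antisymm : ∀ j k, j ≠ k → (rowCross B P j k).transpose = -rowCross B P j k
  bounded : ∃ C : ℝ, 0 < C ∧ ∀ j k, j ≠ k → opNorm (rowCross B P j k) ≤ C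
  covariance : ∀ j, rowCross B P j j = σ ^ 2 • (1 : Matrix (Fin d) (Fin d) ℝ)

/-- The `(i, j)` block of an `n × n` block matrix with `d × d` blocks. -/
def block {n d : ℕ} (A : Matrix (Fin n × Fin d) (Fin n × Fin d) ℝ) (i j : Fin n) :
    Matrix (Fin d) (Fin d) ℝ :=
  Matrix.of fun a b => A (i, a) (j, b)

/-- The block-diagonal part: the blocks off the diagonal are replaced by `0`. -/
def blockDiagPart {n d : ℕ} (A : Matrix (Fin n × Fin d) (Fin n × Fin d) ℝ) :
    Matrix (Fin n × Fin d) (Fin n × Fin d) ℝ :=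
  Matrix.of fun p q => if p.1 = q.1 then A p q else 0

/-- The spectral distribution of a real symmetric matrix: mass `1 / N` at each eigenvalue, counted
with multiplicity. -/
noncomputable def spectralDistribution {ι : Type*} [Fintype ι] [DecidableEq ι]
    {A : Matrix ι ι ℝ} (hA : A.IsHermitian) : Measure ℝ :=
  (Fintype.card ι : ENNReal)⁻¹ • ∑ i, Measure.dirac (hA.eigenvalues i)

theorem isHermitian_smul {ι : Type*} {A : Matrix ι ι ℝ} (hA : A.IsHermitian) (c : ℝ) :
    (c • A).IsHermitian :=
  hA.smul (IsSelfAdjoint.all c)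

/-- The Wigner semicircle law, with density `√(4 - x²) / (2π)` on `[-2, 2]` (`Real.sqrt` vanishes
at negative numbers). -/
noncomputable def semicircle : Measure ℝ :=
  volume.withDensity fun x => ENNReal.ofReal (Real.sqrt (4 - x ^ 2) / (2 * Real.pi))

/-- The semicircle law scaled by `c`: the law of `c * X` when `X` has the semicircle law. -/
noncomputable def scaledSemicircle (c : ℝ) : Measure ℝ :=
  semicircle.map fun x => c * x

/-- For every `n`, the `n × n` block matrix `M n` is random and symmetric, and its blocks strictly
above the block diagonal are i.i.d. with law `ν`. Nothing is said about the diagonal blocks. -/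
structure IsBlockModel {Ω : Type*} [MeasurableSpace Ω] {d : ℕ} (P : Measure Ω)
    (ν : Measure (Matrix (Fin d) (Fin d) ℝ))
    (M : (n : ℕ) → Ω → Matrix (Fin n × Fin d) (Fin n × Fin d) ℝ) : Prop where
  measurable : ∀ n, Measurable (M n)
  isHermitian : ∀ n ω, (M n ω).IsHermitian
  hasLaw : ∀ n (i j : Fin n), i < j → HasLaw (fun ω => block (M n ω) i j) ν P
  indep : ∀ n, iIndepFun
    (fun (p : {p : Fin n × Fin n // p.1 < p.2}) ω => block (M n ω) p.1.1 p.1.2) P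

/-- `M (n + 1)` is obtained from `M n` by adding a last block row and block column whose blocks
(the diagonal one included) are, jointly, independent of `M n`. -/
structure IsBordered {Ω : Type*} [MeasurableSpace Ω] {d : ℕ} (P : Measure Ω)
    (M : (n : ℕ) → Ω → Matrix (Fin n × Fin d) (Fin n × Fin d) ℝ) : Prop where
  nested : ∀ n ω (i j : Fin n),
    block (M (n + 1) ω) i.castSucc j.castSucc = block (M n ω) i j
  indep : ∀ n, IndepFun (M n)
    (fun ω (i : Fin (n + 1)) => block (M (n + 1) ω) i (Fin.last n)) P

end HaarBlocks

/-!
Part (i) only uses that the law `ν` is carried by orthogonal matrices, is centred, and is invariant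
under left multiplication by quarter turns in coordinate planes (`IsOrthogonalLaw`). Quarter turns
relate the second moments of different rows, and orthogonality fixes their common value
(`IsOrthogonalLaw.hasSimpleStructure`).

For part (ii), the off-diagonal part of `M n` is treated by nonbacktracking walks. Since each block
above the diagonal is orthogonal, a step followed by its reversal contributes the identity matrix.
Hence the matrices summing over the nonbacktracking walks of length `k` satisfy, up to terms of
relative order `1 / n`, the recurrence of the Chebyshev polynomials `S k`
(`nbMatrix_succ_eq_chebyshev`). Their traces are small. In the second moment of such a trace, a pair
of closed walks contributes only if every edge is traversed at least twice, because the blocks are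
independent and centred. The union of two closed nonbacktracking walks has at least as many edges as
vertices, so a contributing pair of walks of length `k` visits at most `k` blocks
(`card_walkVertices_union_le_length`), and the second moment is `O(n ^ k)`
(`integral_trace_nbMatrix_sq_le`). After normalization this is `O(1 / n ^ 2)`, so by Borel–Cantelli
the normalized traces of all `S k` with `k ≥ 1` tend to `0` almost surely. The integrals of these
`S k` against the semicircle law vanish as well (`integral_eval_S_semicircle`), so almost surely all
moments converge (`IsBlockModel.ae_tendsto_trace_aeval`), and the method of moments gives weak
convergence (`tendsto_integral_of_tendsto_polynomial`).

The diagonal part is a perturbation. Removing the few coordinates that belong to large diagonal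
blocks changes the eigenvalue counting function little, by interlacing, and the remaining diagonal
blocks have small norm. Interlacing is tested against monotone Lipschitz functions
(`abs_integral_spectralDistribution_sub_le`), and these suffice for weak convergence
(`tendsto_integral_of_monotone`). The result is a deterministic statement: convergence of moments of
the off-diagonal part and a vanishing proportion of large diagonal blocks imply weak convergence
(`tendsto_integral_spectralDistribution`). If the diagonal part is negligible in probability, there
are almost surely no large blocks along suitable subsequences, which gives convergence in
probability. In the bordered case the diagonal blocks are independent. That none of the first `n` is
large with probability at least `1 / 2` then bounds the expected number of large ones by a constant,
and Borel–Cantelli along powers of `2` shows that their proportion vanishes almost surely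
(`IsBordered.ae_tendsto_card_badBlocks`).
-/

namespace HaarBlocks

/-! ### Haar measures of the orthogonal groups -/

section Haar

variable {d : ℕ}

/-- The rotation by a right angle in the coordinate plane `(j, k)`: left multiplication by it
moves row `k` to position `j` and the negative of row `j` to position `k`. -/
noncomputable def quarterTurn (j k : Fin d) : Matrix (Fin d) (Fin d) ℝ :=
  Matrix.diagonal (Function.update 1 k (-1)) * (Equiv.swap j k).permMatrix ℝ

theorem quarterTurn_mul_apply (j k : Fin d) (B : Matrix (Fin d) (Fin d) ℝ) (i a : Fin d) :
    (quarterTurn j k * B) i a =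
      Function.update (1 : Fin d → ℝ) k (-1) i * B (Equiv.swap j k i) a := by
  rw [quarterTurn, Matrix.mul_assoc, Matrix.diagonal_mul, Equiv.Perm.permMatrix,
    PEquiv.toMatrix_toPEquiv_mul]
  rfl

theorem quarterTurn_mul_apply_left {j k : Fin d} (h : j ≠ k) (B : Matrix (Fin d) (Fin d) ℝ)
    (a : Fin d) : (quarterTurn j k * B) j a = B k a := by
  simp [quarterTurn_mul_apply, Function.update_of_ne h]

theorem quarterTurn_mul_apply_right (j k : Fin d) (B : Matrix (Fin d) (Fin d) ℝ)
    (a : Fin d) : (quarterTurn j k * B) k a = -B j a := by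
  simp [quarterTurn_mul_apply]

theorem quarterTurn_mem_specialOrthogonalGroup {j k : Fin d} (h : j ≠ k) :
    quarterTurn j k ∈ Matrix.specialOrthogonalGroup (Fin d) ℝ := by
  rw [Matrix.mem_specialOrthogonalGroup_iff]
  constructor
  · rw [quarterTurn]
    refine mul_mem ?_ ?_
    · rw [Matrix.mem_orthogonalGroup_iff, Matrix.diagonal_transpose,
        Matrix.diagonal_mul_diagonal, ← Matrix.diagonal_one]
      congr 1
      ext i
      by_cases hi : i = k
      · subst hi; simp
      · simp [Function.update_of_ne hi]
    · rw [Matrix.mem_orthogonalGroup_iff, Matrix.transpose_permMatrix, ← Matrix.permMatrix_mul]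
      simp
  · rw [quarterTurn, Matrix.det_mul, Matrix.det_diagonal, Matrix.det_permutation,
      Equiv.Perm.sign_swap h, Finset.prod_update_of_mem (Finset.mem_univ k)]
    simp

/-- What the argument uses of the Haar measures of `O(d)` and `SO(d)`: a probability measure
carried by the orthogonal matrices, invariant under left multiplication by quarter turns, with
centred entries. -/
structure IsOrthogonalLaw (ν : Measure (Matrix (Fin d) (Fin d) ℝ)) : Prop where
  prob : IsProbabilityMeasure ν
  orth : ∀ᵐ B ∂ν, B * B.transpose = 1
  map_quarterTurn : ∀ j k, j ≠ k → ν.map (fun B => quarterTurn j k * B) = ν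
  mean_zero : ∀ i j, ∫ B, B i j ∂ν = 0

theorem isProbabilityMeasure_haarMeasure_top {G : Type*} [Group G] [TopologicalSpace G]
    [IsTopologicalGroup G] [CompactSpace G] [MeasurableSpace G] [BorelSpace G] :
    IsProbabilityMeasure
      (Measure.haarMeasure (⊤ : TopologicalSpace.PositiveCompacts G)) where
  measure_univ := by
    have h := Measure.haarMeasure_self (K₀ := (⊤ : TopologicalSpace.PositiveCompacts G))
    rwa [TopologicalSpace.PositiveCompacts.coe_top] at h

theorem measurableSet_mul_transpose_eq_one :
    MeasurableSet {B : Matrix (Fin d) (Fin d) ℝ | B * B.transpose = 1} :=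
  (isClosed_eq (by fun_prop) continuous_const).measurableSet

theorem map_val_mul_left {G : Type*} [Group G] [MeasurableSpace G] [MeasurableMul G]
    (μ : Measure G) [μ.IsMulLeftInvariant] (v : G →* Matrix (Fin d) (Fin d) ℝ)
    (hv : Measurable v) (g : G) : (μ.map v).map (fun B => v g * B) = μ.map v := by
  rw [Measure.map_map (by fun_prop) hv]
  conv_rhs => rw [← map_mul_left_eq_self μ g, Measure.map_map hv (by fun_prop)]
  congr 1
  ext x : 1
  simp

theorem integral_quarterTurn_mul {ν : Measure (Matrix (Fin d) (Fin d) ℝ)}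
    (hν : ∀ j k, j ≠ k → ν.map (fun B => quarterTurn j k * B) = ν) {j k : Fin d} (h : j ≠ k)
    {f : Matrix (Fin d) (Fin d) ℝ → ℝ} (hf : Continuous f) :
    ∫ B, f (quarterTurn j k * B) ∂ν = ∫ B, f B ∂ν := by
  conv_rhs => rw [← hν j k h]
  rw [integral_map (by fun_prop) hf.aestronglyMeasurable]

/-- Two applications of a quarter turn change the sign of a row. -/
theorem integral_entry_eq_zero_of_map_quarterTurn {ν : Measure (Matrix (Fin d) (Fin d) ℝ)}
    (hν : ∀ j k, j ≠ k → ν.map (fun B => quarterTurn j k * B) = ν) (hd : 2 ≤ d) (i a : Fin d) :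
    ∫ B, B i a ∂ν = 0 := by
  have : Nontrivial (Fin d) := Fin.nontrivial_iff_two_le.2 hd
  obtain ⟨k, hk⟩ := exists_ne i
  have h1 := integral_quarterTurn_mul hν hk.symm (f := fun B => B i a) (by fun_prop)
  have h2 := integral_quarterTurn_mul hν hk.symm (f := fun B => B k a) (by fun_prop)
  simp only [quarterTurn_mul_apply_left hk.symm, quarterTurn_mul_apply_right, integral_neg]
    at h1 h2
  linarith

theorem isOrthogonalLaw_haarO (d : ℕ) : IsOrthogonalLaw (haarO d) := by
  have hmul : ∀ g : Matrix.orthogonalGroup (Fin d) ℝ,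
      (haarO d).map (fun B => (g : Matrix (Fin d) (Fin d) ℝ) * B) = haarO d := fun g =>
    map_val_mul_left _ (Matrix.orthogonalGroup (Fin d) ℝ).subtype measurable_subtype_coe g
  have hprob : IsProbabilityMeasure (Measure.haarMeasure
      (⊤ : TopologicalSpace.PositiveCompacts (Matrix.orthogonalGroup (Fin d) ℝ))) :=
    isProbabilityMeasure_haarMeasure_top
  have hrot : ∀ j k : Fin d, j ≠ k → (haarO d).map (fun B => quarterTurn j k * B) = haarO d :=
    fun j k h => hmul ⟨_, (Matrix.mem_specialOrthogonalGroup_iff.1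
      (quarterTurn_mem_specialOrthogonalGroup h)).1⟩
  refine ⟨Measure.isProbabilityMeasure_map measurable_subtype_coe.aemeasurable, ?_, hrot, ?_⟩
  · rw [haarO, ae_map_iff measurable_subtype_coe.aemeasurable measurableSet_mul_transpose_eq_one]
    exact ae_of_all _ fun A => (Matrix.mem_orthogonalGroup_iff (Fin d) ℝ).1 A.2
  -- For `d = 1` there are no quarter turns: centring comes from multiplication by `-1`.
  · intro i a
    have h := hmul ⟨-1, by simp [Matrix.mem_orthogonalGroup_iff]⟩
    have h2 : ∫ B, B i a ∂(haarO d) = ∫ B, -B i a ∂(haarO d) := by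
      conv_lhs => rw [← h]
      rw [integral_map (by fun_prop)
        (by fun_prop : Continuous fun B : Matrix (Fin d) (Fin d) ℝ => B i a).aestronglyMeasurable]
      simp
    rw [integral_neg] at h2
    linarith

theorem isOrthogonalLaw_haarSO (hd : 2 ≤ d) : IsOrthogonalLaw (haarSO d) := by
  have hprob : IsProbabilityMeasure (Measure.haarMeasure
      (⊤ : TopologicalSpace.PositiveCompacts (Matrix.specialOrthogonalGroup (Fin d) ℝ))) :=
    isProbabilityMeasure_haarMeasure_top
  have hrot : ∀ j k : Fin d, j ≠ k → (haarSO d).map (fun B => quarterTurn j k * B) = haarSO d :=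
    fun j k h => map_val_mul_left _ (Matrix.specialOrthogonalGroup (Fin d) ℝ).subtype
      measurable_subtype_coe ⟨_, quarterTurn_mem_specialOrthogonalGroup h⟩
  refine ⟨Measure.isProbabilityMeasure_map measurable_subtype_coe.aemeasurable, ?_, hrot,
    integral_entry_eq_zero_of_map_quarterTurn hrot hd⟩
  rw [haarSO, ae_map_iff measurable_subtype_coe.aemeasurable measurableSet_mul_transpose_eq_one]
  exact ae_of_all _ fun A => (Matrix.mem_orthogonalGroup_iff (Fin d) ℝ).1
    (Matrix.mem_specialOrthogonalGroup_iff.1 A.2).1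

theorem abs_apply_le_one_of_mul_transpose {B : Matrix (Fin d) (Fin d) ℝ}
    (hB : B * B.transpose = 1) (i a : Fin d) : |B i a| ≤ 1 := by
  have := entry_norm_bound_of_unitary ((Matrix.mem_orthogonalGroup_iff (Fin d) ℝ).2 hB) i a
  rwa [Real.norm_eq_abs] at this

section SimpleStructure

variable {Ω : Type*} [MeasurableSpace Ω] {P : Measure Ω}
  {ν : Measure (Matrix (Fin d) (Fin d) ℝ)} {B : Ω → Matrix (Fin d) (Fin d) ℝ}

theorem integral_entry_mul_entry_eq (hB : HasLaw B ν P) (j k a b : Fin d) :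
    ∫ ω, B ω j a * B ω k b ∂P = ∫ C, C j a * C k b ∂ν := by
  rw [← hB.map_eq, integral_map hB.aemeasurable
    (by fun_prop : Continuous fun C : Matrix (Fin d) (Fin d) ℝ =>
      C j a * C k b).aestronglyMeasurable]

theorem IsOrthogonalLaw.integral_entry_eq_zero (hν : IsOrthogonalLaw ν) (hB : HasLaw B ν P)
    (i a : Fin d) : ∫ ω, B ω i a ∂P = 0 := by
  rw [← hν.mean_zero i a, ← hB.map_eq, integral_map hB.aemeasurable
    (by fun_prop : Continuous fun C : Matrix (Fin d) (Fin d) ℝ => C i a).aestronglyMeasurable]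

theorem IsOrthogonalLaw.ae_mul_transpose (hν : IsOrthogonalLaw ν) (hB : HasLaw B ν P) :
    ∀ᵐ ω ∂P, B ω * (B ω).transpose = 1 :=
  (hB.ae_iff (p := fun C => C * C.transpose = 1)
    (measurableSet_setOfPred.1 measurableSet_mul_transpose_eq_one)).2 hν.orth

/-- Quarter turns in the plane `(j, k)` give `E[B_ja B_kb] = -E[B_ka B_jb]` and show that
`E[B_ja B_jb]` does not depend on `j`; summing over `j`, orthogonality fixes its value. -/
theorem IsOrthogonalLaw.hasSimpleStructure (hν : IsOrthogonalLaw ν) (hd : 1 ≤ d)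
    (hB : HasLaw B ν P) : HasSimpleStructure (1 / Real.sqrt d) B P where
  moments := by
    refine ⟨1, one_pos, fun i j => ?_⟩
    have := hν.prob
    have : IsFiniteMeasure P := by
      have h := hB.map_eq ▸ hν.prob
      exact ⟨by rw [← Set.preimage_univ (f := B), ← Measure.map_apply_of_aemeasurable
        hB.aemeasurable MeasurableSet.univ, hB.map_eq]; exact measure_lt_top _ _⟩
    refine MemLp.of_bound (C := 1) ?_ ?_
    · exact ((by fun_prop : Measurable fun C : Matrix (Fin d) (Fin d) ℝ =>
        C i j).comp_aemeasurable hB.aemeasurable).aestronglyMeasurable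
    · filter_upwards [hν.ae_mul_transpose hB] with ω h
      exact abs_apply_le_one_of_mul_transpose h i j
  antisymm := by
    intro j k h
    ext a b
    have := integral_quarterTurn_mul hν.map_quarterTurn h
      (f := fun C => C j b * C k a) (by fun_prop)
    simp only [quarterTurn_mul_apply_left h, quarterTurn_mul_apply_right, mul_neg,
      integral_neg] at this
    simp only [rowCross, Matrix.transpose_apply, Matrix.of_apply, Matrix.neg_apply,
      integral_entry_mul_entry_eq hB]
    rw [← this]
    simp only [mul_comm]
  bounded := by
    refine ⟨1 + ∑ j, ∑ k, opNorm (rowCross B P j k), ?_, fun j k _ => ?_⟩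
    -- The sum of all the norms bounds each of them; adding `1` makes the constant positive.
    · have : 0 ≤ ∑ j, ∑ k, opNorm (rowCross B P j k) :=
        Finset.sum_nonneg fun _ _ => Finset.sum_nonneg fun _ _ => norm_nonneg _
      linarith
    · have h1 := Finset.single_le_sum (f := fun k => opNorm (rowCross B P j k))
        (fun _ _ => norm_nonneg _) (Finset.mem_univ k)
      have h2 := Finset.single_le_sum (f := fun j => ∑ k, opNorm (rowCross B P j k))
        (fun _ _ => Finset.sum_nonneg fun _ _ => norm_nonneg _) (Finset.mem_univ j)
      linarith
  covariance := by
    intro j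
    ext a b
    have hp := hν.prob
    have hd' : (d : ℝ) ≠ 0 := by positivity
    have hint : ∀ i, Integrable (fun C : Matrix (Fin d) (Fin d) ℝ => C i a * C i b) ν := by
      intro i
      refine Integrable.of_bound (C := 1)
        (by fun_prop : Continuous fun C : Matrix (Fin d) (Fin d) ℝ =>
          C i a * C i b).aestronglyMeasurable ?_
      filter_upwards [hν.orth] with C hC
      rw [norm_mul]
      exact mul_le_one₀ (abs_apply_le_one_of_mul_transpose hC i a) (norm_nonneg _)
        (abs_apply_le_one_of_mul_transpose hC i b)
    have hconst : ∀ i, ∫ C, C i a * C i b ∂ν = ∫ C, C j a * C j b ∂ν := by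
      intro i
      rcases eq_or_ne j i with rfl | h
      · rfl
      have := integral_quarterTurn_mul hν.map_quarterTurn h
        (f := fun C => C j a * C j b) (by fun_prop)
      simpa only [quarterTurn_mul_apply_left h] using this
    have hsum : ∑ i, ∫ C, C i a * C i b ∂ν = (1 : Matrix (Fin d) (Fin d) ℝ) a b := by
      rw [← integral_finsetSum _ fun i _ => hint i]
      have : ∀ᵐ C ∂ν, ∑ i, C i a * C i b = (1 : Matrix (Fin d) (Fin d) ℝ) a b := by
        filter_upwards [hν.orth] with C hC
        rw [← mul_eq_one_comm.1 hC]
        simp [Matrix.mul_apply]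
      rw [integral_congr_ae this]
      simp
    rw [Finset.sum_congr rfl fun i _ => hconst i] at hsum
    simp only [Finset.sum_const, Finset.card_univ, Fintype.card_fin, nsmul_eq_mul] at hsum
    simp only [rowCross, Matrix.of_apply, integral_entry_mul_entry_eq hB, Matrix.smul_apply,
      smul_eq_mul, div_pow, one_pow, Real.sq_sqrt (Nat.cast_nonneg d)]
    rw [← hsum]
    field_simp

end SimpleStructure

end Haar

/-! ### Nonbacktracking matrices and the Chebyshev recursion -/

section Walks

variable {ι κ : Type*}

/-- The walk `w` does not return to the block it visited two steps earlier, where the block visited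
before `w 0` is taken to be `p`. -/
def IsNonbacktracking : (k : ℕ) → ι → (Fin (k + 1) → ι × κ) → Prop
  | 0, _, _ => True
  | k + 1, p, w => (w 1).1 ≠ p ∧ IsNonbacktracking k (w 0).1 (Fin.tail w)

theorem IsNonbacktracking.apply_ne {k : ℕ} {p : ι} {w : Fin (k + 1) → ι × κ}
    (hw : IsNonbacktracking k p w) (t : ℕ) (ht : t + 2 < k + 1) :
    (w ⟨t + 2, ht⟩).1 ≠ (w ⟨t, by omega⟩).1 := by
  induction k generalizing p t with
  | zero => omega
  | succ k ih =>
    cases t with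
    | zero =>
      cases k with
      | zero => omega
      | succ k => exact hw.2.1
    | succ t => exact ih hw.2 t (by omega)

end Walks

section Nonbacktracking

variable {ι κ : Type*} [Fintype ι] [Fintype κ] [DecidableEq ι] [DecidableEq κ]

/-- `nbRow A k p x y` sums the products of entries of `A` along the nonbacktracking walks of
length `k` from `x` to `y` whose first step does not enter the block `p`; "nonbacktracking" refers
to the walk of blocks. -/
noncomputable def nbRow (A : Matrix (ι × κ) (ι × κ) ℝ) : ℕ → ι → ι × κ → ι × κ → ℝ
  | 0, _, x, y => if x = y then 1 else 0
  | k + 1, p, x, y => ∑ z, if z.1 = p then 0 else A x z * nbRow A k x.1 z y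

/-- The `k`-th nonbacktracking matrix of `A`. A walk starting in a block cannot stay there in its
first step when the diagonal blocks vanish, so forbidding that block imposes no condition. -/
noncomputable def nbMatrix (A : Matrix (ι × κ) (ι × κ) ℝ) (k : ℕ) : Matrix (ι × κ) (ι × κ) ℝ :=
  Matrix.of fun x y => nbRow A k x.1 x y

/-- The diagonal blocks of `A` vanish, and for `i ≠ j` the `(i, j)` and `(j, i)` blocks are
inverse to each other. -/
structure HasInverseBlocks (A : Matrix (ι × κ) (ι × κ) ℝ) : Prop where
  diag : ∀ x y, x.1 = y.1 → A x y = 0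
  inv : ∀ i j, i ≠ j → ∀ a b, ∑ c, A (i, a) (j, c) * A (j, c) (i, b) = if a = b then 1 else 0

variable {A : Matrix (ι × κ) (ι × κ) ℝ}

theorem nbMatrix_succ_apply (hA : HasInverseBlocks A) (k : ℕ) (x y : ι × κ) :
    nbMatrix A (k + 1) x y = ∑ z, A x z * nbRow A k x.1 z y := by
  simp only [nbMatrix, Matrix.of_apply, nbRow]
  refine Finset.sum_congr rfl fun z _ => ?_
  split_ifs with h
  · rw [hA.diag x z h.symm, zero_mul]
  · rfl

theorem nbMatrix_one (hA : HasInverseBlocks A) : nbMatrix A 1 = A := by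
  ext x y
  rw [nbMatrix_succ_apply hA]
  simp [nbRow]

/-- The walks whose first step avoids the block `p` are all the walks except those entering `p`. -/
theorem nbRow_succ_eq_sub (hA : HasInverseBlocks A) (k : ℕ) (p : ι) (x y : ι × κ) :
    nbRow A (k + 1) p x y =
      nbMatrix A (k + 1) x y - ∑ c, A x (p, c) * nbRow A k x.1 (p, c) y := by
  have h : ∑ c, A x (p, c) * nbRow A k x.1 (p, c) y =
      ∑ z, if z.1 = p then A x z * nbRow A k x.1 z y else 0 := by
    rw [Fintype.sum_prod_type, Finset.sum_eq_single p]
    · simp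
    · intro i _ hi
      simp [hi]
    · simp
  rw [nbMatrix_succ_apply hA, h, nbRow, ← Finset.sum_sub_distrib]
  refine Finset.sum_congr rfl fun z _ => ?_
  split_ifs <;> simp

/-- A walk preceded by an extra step either stays nonbacktracking or backtracks at once, in which
case the first two steps cancel because opposite blocks are inverse. -/
theorem mul_nbMatrix_succ_apply (hA : HasInverseBlocks A) (k : ℕ) (x y : ι × κ) :
    (A * nbMatrix A (k + 1)) x y =
      nbMatrix A (k + 2) x y + ∑ j ∈ Finset.univ.erase x.1, nbRow A k j x y := by
  rw [Matrix.mul_apply, nbMatrix_succ_apply hA]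
  have h : ∀ z, A x z * nbMatrix A (k + 1) z y = A x z * nbRow A (k + 1) x.1 z y +
      ∑ c, A x z * A z (x.1, c) * nbRow A k z.1 (x.1, c) y := by
    intro z
    rw [nbRow_succ_eq_sub hA, mul_sub, Finset.mul_sum]
    simp only [mul_assoc, sub_add_cancel]
  rw [Finset.sum_congr rfl fun z _ => h z, Finset.sum_add_distrib]
  congr 1
  rw [Fintype.sum_prod_type, ← Finset.add_sum_erase _ _ (Finset.mem_univ x.1)]
  have h0 : ∑ b, ∑ c, A x (x.1, b) * A (x.1, b) (x.1, c) * nbRow A k x.1 (x.1, c) y = 0 :=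
    Finset.sum_eq_zero fun b _ => Finset.sum_eq_zero fun c _ => by
      rw [hA.diag x (x.1, b) rfl, zero_mul, zero_mul]
  rw [h0, zero_add]
  refine Finset.sum_congr rfl fun j hj => ?_
  rw [Finset.sum_comm]
  have h1 : ∀ c, ∑ b, A x (j, b) * A (j, b) (x.1, c) * nbRow A k j (x.1, c) y =
      (if x.2 = c then 1 else 0) * nbRow A k j (x.1, c) y := by
    intro c
    rw [← Finset.sum_mul]
    congr 1
    exact hA.inv x.1 j (Finset.ne_of_mem_erase hj).symm x.2 c
  rw [Finset.sum_congr rfl fun c _ => h1 c]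
  simp

/-- After a backtracking first pair of steps nothing is left of a walk of length `2`; the
`card ι - 1` blocks it may have turned back from each contribute the identity. -/
theorem mul_nbMatrix_one (hA : HasInverseBlocks A) :
    A * nbMatrix A 1 = nbMatrix A 2 + ((Fintype.card ι : ℝ) - 1) • 1 := by
  ext x y
  have : 1 ≤ Fintype.card ι := Fintype.card_pos_iff.2 ⟨x.1⟩
  rw [mul_nbMatrix_succ_apply hA 0]
  simp [nbRow, Matrix.one_apply, Finset.card_erase_of_mem, Nat.cast_sub this]

/-- After a backtracking first pair of steps through the block `j`, the rest of the walk is any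
nonbacktracking walk not entering `j`. Summing over the `card ι - 1` choices of `j`, each walk is
counted once for every `j` other than the block it enters. -/
theorem mul_nbMatrix_add_two (hA : HasInverseBlocks A) (k : ℕ) :
    A * nbMatrix A (k + 2) =
      nbMatrix A (k + 3) + ((Fintype.card ι : ℝ) - 2) • nbMatrix A (k + 1) := by
  ext x y
  have : 1 ≤ Fintype.card ι := Fintype.card_pos_iff.2 ⟨x.1⟩
  rw [mul_nbMatrix_succ_apply hA (k + 1), Matrix.add_apply, Matrix.smul_apply, smul_eq_mul]
  congr 1
  rw [Finset.sum_congr rfl fun j _ => nbRow_succ_eq_sub hA k j x y, Finset.sum_sub_distrib]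
  have h : ∑ j ∈ Finset.univ.erase x.1, ∑ c, A x (j, c) * nbRow A k x.1 (j, c) y =
      nbMatrix A (k + 1) x y := by
    rw [nbMatrix_succ_apply hA, Fintype.sum_prod_type,
      ← Finset.add_sum_erase _ _ (Finset.mem_univ x.1)]
    have h0 : ∑ c, A x (x.1, c) * nbRow A k x.1 (x.1, c) y = 0 :=
      Finset.sum_eq_zero fun c _ => by rw [hA.diag x (x.1, c) rfl, zero_mul]
    rw [h0, zero_add]
  rw [h]
  simp [Finset.card_erase_of_mem, Nat.cast_sub this]
  ring

open Polynomial Chebyshev in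
/-- With `m = card ι - 2`, the nonbacktracking matrices are, up to the factor `m ^ (k / 2)` and a
correction of order `1 / m`, the Chebyshev polynomials `S k` of `A / √m`. -/
theorem nbMatrix_succ_eq_chebyshev (hA : HasInverseBlocks A) {s : ℝ} (hs : s ≠ 0)
    (hcard : (Fintype.card ι : ℝ) - 2 = s ^ 2) (k : ℕ) :
    nbMatrix A (k + 1) = s ^ (k + 1) • (aeval (s⁻¹ • A) (S ℝ ((k : ℤ) + 1)) -
      (s ^ 2)⁻¹ • aeval (s⁻¹ • A) (S ℝ ((k : ℤ) - 1))) := by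
  have hAs : A = s • (s⁻¹ • A) := by rw [smul_smul, mul_inv_cancel₀ hs, one_smul]
  induction k using Nat.twoStepInduction with
  | zero => simp [nbMatrix_one hA, smul_smul, hs]
  | one =>
    have h := mul_nbMatrix_one hA
    rw [nbMatrix_one hA, show (Fintype.card ι : ℝ) - 1 = s ^ 2 + 1 by linarith] at h
    rw [eq_sub_of_add_eq h.symm]
    have h2 : S ℝ (((1 : ℕ) : ℤ) + 1) = X ^ 2 - 1 := by
      rw [← S_two]; norm_num
    have h3 : S ℝ (((1 : ℕ) : ℤ) - 1) = 1 := by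
      rw [← S_zero]; norm_num
    rw [h2, h3]
    simp only [map_sub, map_pow, aeval_X, map_one, smul_sub, _root_.smul_pow, smul_smul, add_smul,
      one_smul, Nat.reduceAdd]
    rw [mul_inv_cancel₀ (pow_ne_zero 2 hs), ← mul_pow, mul_inv_cancel₀ hs, pow_two A]
    simp [sub_sub]
  | more k ih1 ih2 =>
    have h := mul_nbMatrix_add_two hA k
    rw [hcard] at h
    rw [show k + 2 + 1 = k + 3 from rfl, eq_sub_of_add_eq h.symm, ih1, ih2]
    have e1 : S ℝ (((k + 2 : ℕ) : ℤ) + 1) =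
        X * S ℝ (((k + 1 : ℕ) : ℤ) + 1) - S ℝ ((k : ℤ) + 1) := by
      rw [S_add_one]; push_cast; ring_nf
    have e2 : S ℝ (((k + 2 : ℕ) : ℤ) - 1) =
        X * S ℝ (((k + 1 : ℕ) : ℤ) - 1) - S ℝ ((k : ℤ) - 1) := by
      rw [S_eq]; push_cast; ring_nf
    rw [e1, e2]
    simp only [map_sub, map_mul, aeval_X]
    generalize aeval (s⁻¹ • A) (S ℝ (((k + 1 : ℕ) : ℤ) + 1)) = a
    generalize aeval (s⁻¹ • A) (S ℝ (((k + 1 : ℕ) : ℤ) - 1)) = b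
    generalize aeval (s⁻¹ • A) (S ℝ ((k : ℤ) + 1)) = c
    generalize aeval (s⁻¹ • A) (S ℝ ((k : ℤ) - 1)) = e
    simp only [mul_smul_comm, smul_mul_assoc, mul_sub, smul_sub, smul_smul]
    have h1 : s ^ (k + 1 + 1) = s ^ (k + 3) * s⁻¹ := by field_simp; ring
    have h2 : s ^ 2 * s ^ (k + 1) = s ^ (k + 3) := by ring
    simp only [h1, h2, ← mul_assoc]
    rw [show s ^ (k + 3) * s⁻¹ * (s ^ 2)⁻¹ = s ^ (k + 2 + 1) * (s ^ 2)⁻¹ * s⁻¹ by ring]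
    abel

open Classical in
theorem nbRow_eq_sum (A : Matrix (ι × κ) (ι × κ) ℝ) (k : ℕ) (p : ι) (x y : ι × κ) :
    nbRow A k p x y = ∑ w : Fin (k + 1) → ι × κ,
      if w 0 = x ∧ w (Fin.last k) = y ∧ IsNonbacktracking k p w then
        ∏ t : Fin k, A (w t.castSucc) (w t.succ) else 0 := by
  induction k generalizing p x with
  | zero =>
    rw [← (Equiv.funUnique (Fin 1) (ι × κ)).symm.sum_comp]
    simp [nbRow, IsNonbacktracking, ite_and]
  | succ k ih =>
    symm
    rw [nbRow, ← (Fin.consEquiv fun _ => ι × κ).sum_comp, Fintype.sum_prod_type (α₁ := ι × κ),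
      Finset.sum_eq_single x]
    · symm
      simp only [ih, Finset.mul_sum]
      have h : ∀ z, (if z.1 = p then 0 else ∑ w : Fin (k + 1) → ι × κ, A x z *
          if w 0 = z ∧ w (Fin.last k) = y ∧ IsNonbacktracking k x.1 w then
            ∏ t : Fin k, A (w t.castSucc) (w t.succ) else 0) =
          ∑ w : Fin (k + 1) → ι × κ, if w 0 = z then
            (if z.1 ≠ p ∧ w (Fin.last k) = y ∧ IsNonbacktracking k x.1 w then
            A x z * ∏ t : Fin k, A (w t.castSucc) (w t.succ) else 0) else 0 := by
        intro z
        by_cases hz : z.1 = p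
        · simp [hz]
        · simp [hz, ite_and]
      rw [Finset.sum_congr rfl fun z _ => h z, Finset.sum_comm]
      refine Finset.sum_congr rfl fun w _ => ?_
      rw [Finset.sum_ite_eq, if_pos (Finset.mem_univ _)]
      simp only [Fin.consEquiv, Equiv.coe_fn_mk, Fin.cons_zero, true_and, IsNonbacktracking,
        Fin.tail_cons, Fin.prod_univ_succ (n := k), ← Fin.succ_last, Fin.cons_succ,
        Fin.castSucc_zero, Fin.castSucc_succ, show (1 : Fin (k + 2)) = Fin.succ 0 from rfl]
      congr 1
      simp only [eq_iff_iff]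
      tauto
    · intro z _ hz
      refine Finset.sum_eq_zero fun w _ => ?_
      rw [if_neg]
      simp [Fin.consEquiv, hz]
    · simp

open Classical in
theorem trace_nbMatrix_eq_sum (A : Matrix (ι × κ) (ι × κ) ℝ) (k : ℕ) :
    (nbMatrix A k).trace = ∑ w : Fin (k + 1) → ι × κ,
      if w (Fin.last k) = w 0 ∧ IsNonbacktracking k (w 0).1 w then
        ∏ t : Fin k, A (w t.castSucc) (w t.succ) else 0 := by
  simp only [Matrix.trace, Matrix.diag, nbMatrix, Matrix.of_apply, nbRow_eq_sum]
  rw [Finset.sum_comm]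
  refine Finset.sum_congr rfl fun w _ => ?_
  rw [Finset.sum_eq_single (w 0)]
  · simp
  · intro x _ hx
    rw [if_neg fun h => hx h.1.symm]
  · simp

end Nonbacktracking

/-! ### Counting closed nonbacktracking walks -/

section ClosedWalks

variable {α : Type*} [DecidableEq α]

/-- The vertices visited by the walk `u` during its first `k` steps. -/
def walkVertices (u : ℕ → α) (k : ℕ) : Finset α :=
  (Finset.range k).image u

/-- The edges traversed by the walk `u` during its first `k` steps. -/
def walkEdges (u : ℕ → α) (k : ℕ) : Finset (Sym2 α) :=
  (Finset.range k).image fun t => s(u t, u (t + 1))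

/-- The times before `k` at which the walk `u` visits a vertex for the first time. -/
def firstVisits (u : ℕ → α) (k : ℕ) : Finset ℕ :=
  {t ∈ Finset.range k | ∀ s < t, u s ≠ u t}

theorem mem_firstVisits {u : ℕ → α} {k t : ℕ} :
    t ∈ firstVisits u k ↔ t < k ∧ ∀ s < t, u s ≠ u t := by
  simp [firstVisits]

theorem eq_of_mem_firstVisits {u : ℕ → α} {k t t' : ℕ} (h : t ∈ firstVisits u k)
    (h' : t' ∈ firstVisits u k) (he : u t = u t') : t = t' := by
  rw [mem_firstVisits] at h h'
  rcases lt_trichotomy t t' with hlt | heq | hgt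
  · exact absurd he (h'.2 t hlt)
  · exact heq
  · exact absurd he.symm (h.2 t' hgt)

theorem walkVertices_subset_image_firstVisits (u : ℕ → α) (k : ℕ) :
    walkVertices u k ⊆ (firstVisits u k).image u := by
  intro v hv
  simp only [walkVertices, Finset.mem_image, Finset.mem_range] at hv
  have hex : ∃ t, u t = v := ⟨hv.choose, hv.choose_spec.2⟩
  rw [Finset.mem_image]
  refine ⟨Nat.find hex, ?_, Nat.find_spec hex⟩
  rw [mem_firstVisits]
  refine ⟨lt_of_le_of_lt (Nat.find_min' hex hv.choose_spec.2) hv.choose_spec.1, fun s hs => ?_⟩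
  rw [Nat.find_spec hex]
  exact Nat.find_min hex hs

/-- The edge entering a vertex at its first visit determines the time of this visit. -/
theorem eq_of_entering_edge_eq {u : ℕ → α} {k t t' : ℕ} (h : t ∈ firstVisits u k)
    (h' : t' ∈ firstVisits u k)
    (he : s(u (t - 1), u t) = s(u (t' - 1), u t')) : t = t' := by
  rcases Sym2.eq_iff.1 he with ⟨_, h2⟩ | ⟨h1, h2⟩
  · exact eq_of_mem_firstVisits h h' h2
  · have h3 : ¬ t - 1 < t' := fun hlt => (mem_firstVisits.1 h').2 _ hlt h1
    have h4 : ¬ t' - 1 < t := fun hlt => (mem_firstVisits.1 h).2 _ hlt h2.symm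
    omega

/-- A closed nonbacktracking walk traverses at least as many edges as it visits vertices. The edges
entering new vertices account for all vertices but the starting point. The edge by which the walk
leaves the last new vertex is not among them, since the walk does not backtrack. -/
theorem card_walkVertices_le {u : ℕ → α} {k : ℕ} (hk : 0 < k) (hclosed : u k = u 0)
    (hloop : ∀ t < k, u t ≠ u (t + 1)) (hnb : ∀ t, t + 2 ≤ k → u (t + 2) ≠ u t) :
    (walkVertices u k).card ≤ (walkEdges u k).card := by
  have hk2 : 1 < k := by
    rcases Nat.lt_or_ge 1 k with h | h
    · exact h
    · obtain rfl : k = 1 := by omega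
      exact absurd hclosed.symm (hloop 0 hk)
  have hT1 : 1 ∈ firstVisits u k := by
    rw [mem_firstVisits]
    refine ⟨hk2, fun s hs => ?_⟩
    obtain rfl : s = 0 := by omega
    exact hloop 0 hk
  obtain ⟨m, hm, hmax⟩ := (firstVisits u k).exists_max_image id ⟨1, hT1⟩
  have hm1 : 1 ≤ m := hmax 1 hT1
  have hmk : m < k := (mem_firstVisits.1 hm).1
  have hlast : ∀ t ∈ firstVisits u k, t ≠ 0 → s(u (t - 1), u t) ≠ s(u m, u (m + 1)) := by
    intro t ht ht0 he
    rcases Sym2.eq_iff.1 he with ⟨h1, _⟩ | ⟨h1, h2⟩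
    · have h3 : ¬ t - 1 < m := fun hlt => (mem_firstVisits.1 hm).2 _ hlt h1
      have := hmax t ht
      simp only [id] at this
      omega
    · obtain rfl := eq_of_mem_firstVisits ht hm h2
      refine hnb (t - 1) (by omega) ?_
      rw [show t - 1 + 2 = t + 1 by omega]
      exact h1.symm
  calc (walkVertices u k).card ≤ ((firstVisits u k).image u).card :=
        Finset.card_le_card (walkVertices_subset_image_firstVisits u k)
    _ ≤ (firstVisits u k).card := Finset.card_image_le
    _ ≤ (walkEdges u k).card := by
      refine Finset.card_le_card_of_injOn
        (fun t => if t = 0 then s(u m, u (m + 1)) else s(u (t - 1), u t)) ?_ ?_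
      · intro t ht
        have htk := (mem_firstVisits.1 ht).1
        simp only [walkEdges, Finset.coe_image, Set.mem_image, Finset.coe_range, Set.mem_Iio]
        split_ifs with h0
        · exact ⟨m, hmk, rfl⟩
        · exact ⟨t - 1, by omega, by rw [Nat.sub_add_cancel (by omega)]⟩
      · intro t ht t' ht' he
        simp only at he
        split_ifs at he with h0 h0' h0'
        · rw [h0, h0']
        · exact absurd he.symm (hlast t' ht' h0')
        · exact absurd he (hlast t ht h0)
        · exact eq_of_entering_edge_eq ht ht' he

/-- Adjoining a walk that starts in `S` to a graph on `S` with at least as many edges as vertices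
keeps this inequality: each new vertex comes with the new edge entering it first. -/
theorem card_union_walkVertices_le {S : Finset α} {F : Finset (Sym2 α)}
    (hF : ∀ e ∈ F, ∀ v ∈ e, v ∈ S) (hSF : S.card ≤ F.card) {c : ℕ → α} (k : ℕ) (hc : c 0 ∈ S) :
    (S ∪ walkVertices c k).card ≤ (F ∪ walkEdges c k).card := by
  have hne : ∀ t, c t ∉ S → t ≠ 0 := by
    rintro t ht rfl
    exact ht hc
  have hV : (walkVertices c k \ S).card ≤ (walkEdges c k \ F).card := by
    calc (walkVertices c k \ S).card
        ≤ ({t ∈ firstVisits c k | c t ∉ S}.image c).card := by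
          refine Finset.card_le_card fun v hv => ?_
          rw [Finset.mem_sdiff] at hv
          obtain ⟨t, ht, rfl⟩ :=
            Finset.mem_image.1 (walkVertices_subset_image_firstVisits c k hv.1)
          exact Finset.mem_image.2 ⟨t, Finset.mem_filter.2 ⟨ht, hv.2⟩, rfl⟩
      _ ≤ _ := Finset.card_image_le
      _ ≤ (walkEdges c k \ F).card := by
          refine Finset.card_le_card_of_injOn (fun t => s(c (t - 1), c t)) ?_ ?_
          · intro t ht
            rw [Finset.mem_coe, Finset.mem_filter] at ht
            have htk := (mem_firstVisits.1 ht.1).1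
            have h0 := hne t ht.2
            rw [Finset.mem_coe, Finset.mem_sdiff]
            refine ⟨Finset.mem_image.2 ⟨t - 1, Finset.mem_range.2 (by omega), ?_⟩, fun he => ?_⟩
            · rw [Nat.sub_add_cancel (by omega)]
            · exact ht.2 (hF _ he _ (Sym2.mem_mk_right _ _))
          · intro t ht t' ht' he
            rw [Finset.mem_coe, Finset.mem_filter] at ht ht'
            exact eq_of_entering_edge_eq ht.1 ht'.1 he
  rw [← Finset.union_sdiff_self_eq_union, ← Finset.union_sdiff_self_eq_union (s := F),
    Finset.card_union_of_disjoint Finset.disjoint_sdiff,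
    Finset.card_union_of_disjoint Finset.disjoint_sdiff]
  exact add_le_add hSF hV

theorem walkEdges_endpoints {u : ℕ → α} {k : ℕ} (hper : Function.Periodic u k) (hk : 0 < k) :
    ∀ e ∈ walkEdges u k, ∀ v ∈ e, v ∈ walkVertices u k := by
  intro e he v hv
  obtain ⟨t, _, rfl⟩ := Finset.mem_image.1 he
  have h : ∀ r, u r ∈ walkVertices u k := fun r =>
    Finset.mem_image.2 ⟨r % k, Finset.mem_range.2 (Nat.mod_lt _ hk), hper.map_mod_nat r⟩
  rcases Sym2.mem_iff.1 hv with rfl | rfl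
  · exact h _
  · exact h _

/-- The union of two closed nonbacktracking walks has at least as many edges as vertices. -/
theorem card_walkVertices_union_le {u u' : ℕ → α} {k : ℕ} (hk : 0 < k)
    (hper : Function.Periodic u k) (hper' : Function.Periodic u' k)
    (hloop : ∀ t < k, u t ≠ u (t + 1)) (hnb : ∀ t, t + 2 ≤ k → u (t + 2) ≠ u t)
    (hloop' : ∀ t < k, u' t ≠ u' (t + 1)) (hnb' : ∀ t, t + 2 ≤ k → u' (t + 2) ≠ u' t) :
    (walkVertices u k ∪ walkVertices u' k).card ≤ (walkEdges u k ∪ walkEdges u' k).card := by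
  have h1 := card_walkVertices_le hk (by simpa using hper 0) hloop hnb
  -- If the walks meet, the second one, started at a common vertex, is adjoined to the first;
  -- otherwise vertices and edges are counted separately.
  by_cases hmeet : ∃ s < k, u' s ∈ walkVertices u k
  · obtain ⟨s, hs, hsu⟩ := hmeet
    have h2 := card_union_walkVertices_le (walkEdges_endpoints hper hk) h1
      (c := fun t => u' (t + s)) k (by simpa using hsu)
    refine le_trans (Finset.card_le_card (Finset.union_subset_union_right ?_))
      (h2.trans (Finset.card_le_card (Finset.union_subset_union_right ?_)))
    · intro v hv
      obtain ⟨t, ht, rfl⟩ := Finset.mem_image.1 hv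
      rw [Finset.mem_range] at ht
      rcases Nat.lt_or_ge t s with hlt | hge
      · refine Finset.mem_image.2 ⟨t + k - s, Finset.mem_range.2 (by omega), ?_⟩
        rw [show t + k - s + s = t + k by omega, hper']
      · refine Finset.mem_image.2 ⟨t - s, Finset.mem_range.2 (by omega), ?_⟩
        rw [show t - s + s = t by omega]
    · intro e he
      obtain ⟨t, _, rfl⟩ := Finset.mem_image.1 he
      have hper2 : Function.Periodic (fun t => s(u' t, u' (t + 1))) k := by
        intro t
        simp only
        rw [hper' t, show t + k + 1 = t + 1 + k by omega, hper' (t + 1)]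
      refine Finset.mem_image.2 ⟨(t + s) % k, Finset.mem_range.2 (Nat.mod_lt _ hk), ?_⟩
      rw [hper2.map_mod_nat (t + s)]
      simp only
      rw [show t + 1 + s = t + s + 1 by omega]
  · push Not at hmeet
    have h2 := card_walkVertices_le hk (by simpa using hper' 0) hloop' hnb'
    have hdisj : Disjoint (walkVertices u k) (walkVertices u' k) := by
      rw [Finset.disjoint_right]
      intro v hv
      obtain ⟨t, ht, rfl⟩ := Finset.mem_image.1 hv
      exact hmeet t (Finset.mem_range.1 ht)
    have hdisj' : Disjoint (walkEdges u k) (walkEdges u' k) := by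
      rw [Finset.disjoint_left]
      intro e he he'
      induction e with
      | h a b =>
        exact Finset.disjoint_left.1 hdisj
          (walkEdges_endpoints hper hk _ he _ (Sym2.mem_mk_left a b))
          (walkEdges_endpoints hper' hk _ he' _ (Sym2.mem_mk_left a b))
    rw [Finset.card_union_of_disjoint hdisj, Finset.card_union_of_disjoint hdisj']
    exact add_le_add h1 h2

theorem two_mul_card_image_le {β γ : Type*} [Fintype β] [DecidableEq γ] (f : β → γ)
    (hf : ∀ i, ∃ j, j ≠ i ∧ f j = f i) :
    2 * (Finset.univ.image f).card ≤ Fintype.card β := by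
  classical
  refine Finset.mul_card_image_le_card Finset.univ 2 fun c hc => ?_
  obtain ⟨i, _, rfl⟩ := Finset.mem_image.1 hc
  obtain ⟨j, hj, hfj⟩ := hf i
  exact Finset.one_lt_card.2 ⟨j, by simp [hfj], i, by simp, hj⟩

/-- If two closed nonbacktracking walks of length `k` together traverse every edge at least twice,
then they visit at most `k` vertices in total. -/
theorem card_walkVertices_union_le_length {u u' : ℕ → α} {k : ℕ} (hk : 0 < k)
    (hper : Function.Periodic u k) (hper' : Function.Periodic u' k)
    (hloop : ∀ t < k, u t ≠ u (t + 1)) (hnb : ∀ t, t + 2 ≤ k → u (t + 2) ≠ u t)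
    (hloop' : ∀ t < k, u' t ≠ u' (t + 1)) (hnb' : ∀ t, t + 2 ≤ k → u' (t + 2) ≠ u' t)
    {e : Fin k ⊕ Fin k → Sym2 α}
    (he : e = Sum.elim (fun t : Fin k => s(u t, u (t + 1))) (fun t : Fin k => s(u' t, u' (t + 1))))
    (htwice : ∀ i, ∃ j, j ≠ i ∧ e j = e i) :
    (walkVertices u k ∪ walkVertices u' k).card ≤ k := by
  have h1 := card_walkVertices_union_le hk hper hper' hloop hnb hloop' hnb'
  have h2 := two_mul_card_image_le e htwice
  have h3 : walkEdges u k ∪ walkEdges u' k ⊆ Finset.univ.image e := by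
    subst he
    refine Finset.union_subset ?_ ?_
    · intro x hx
      obtain ⟨t, ht, rfl⟩ := Finset.mem_image.1 hx
      exact Finset.mem_image.2 ⟨Sum.inl ⟨t, Finset.mem_range.1 ht⟩, Finset.mem_univ _, rfl⟩
    · intro x hx
      obtain ⟨t, ht, rfl⟩ := Finset.mem_image.1 hx
      exact Finset.mem_image.2 ⟨Sum.inr ⟨t, Finset.mem_range.1 ht⟩, Finset.mem_univ _, rfl⟩
  have h4 := Finset.card_le_card h3
  simp only [Fintype.card_sum, Fintype.card_fin] at h2
  omega

end ClosedWalks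

section Counting

/-- A map with at most `v` values factors through `Fin v`. -/
theorem card_filter_card_image_le {β ι : Type*} [Fintype β] [Fintype ι] [DecidableEq ι]
    [DecidableEq β] [Nonempty ι] (v : ℕ) :
    (Finset.univ.filter fun g : β → ι => (Finset.univ.image g).card ≤ v).card ≤
      Fintype.card ι ^ v * v ^ Fintype.card β := by
  classical
  calc (Finset.univ.filter fun g : β → ι => (Finset.univ.image g).card ≤ v).card
      ≤ ((Finset.univ : Finset ((Fin v → ι) × (β → Fin v))).image
          fun p => p.1 ∘ p.2).card := by
        refine Finset.card_le_card fun g hg => ?_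
        rw [Finset.mem_filter] at hg
        obtain ⟨q⟩ : Nonempty ((Finset.univ.image g : Finset ι) ↪ Fin v) := by
          rw [Function.Embedding.nonempty_iff_card_le]
          rw [Fintype.card_coe, Fintype.card_fin]
          exact hg.2
        refine Finset.mem_image.2 ⟨(Function.extend q Subtype.val fun _ => Classical.arbitrary ι,
          fun b => q ⟨g b, Finset.mem_image_of_mem g (Finset.mem_univ b)⟩), Finset.mem_univ _, ?_⟩
        ext b
        simp [q.injective.extend_apply]
    _ ≤ _ := Finset.card_image_le
    _ = _ := by simp

end Counting

/-! ### Second moments of traces of nonbacktracking matrices -/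

section PairCounting

/-- The pairs of walks of matrix indices that visit at most `v` blocks in total: the walks of blocks
are counted by `card_filter_card_image_le`, the positions within the blocks are arbitrary. -/
theorem card_filter_pair_le {β ι κ : Type*} [Fintype β] [Fintype ι] [Fintype κ] [DecidableEq ι]
    [DecidableEq β] [DecidableEq κ] [Nonempty ι] (v : ℕ) :
    (Finset.univ.filter fun p : (β → ι × κ) × (β → ι × κ) =>
      (Finset.univ.image (Sum.elim (fun b => (p.1 b).1) fun b => (p.2 b).1)).card ≤ v).card ≤
      Fintype.card ι ^ v * v ^ (2 * Fintype.card β) * Fintype.card κ ^ (2 * Fintype.card β) := by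
  classical
  have h := card_filter_card_image_le (β := β ⊕ β) (ι := ι) v
  rw [Fintype.card_sum, ← two_mul] at h
  calc _ ≤ ((Finset.univ.filter fun g : β ⊕ β → ι => (Finset.univ.image g).card ≤ v) ×ˢ
        (Finset.univ : Finset (β ⊕ β → κ))).card := by
        refine Finset.card_le_card_of_injOn (fun p =>
          (Sum.elim (fun b => (p.1 b).1) fun b => (p.2 b).1,
            Sum.elim (fun b => (p.1 b).2) fun b => (p.2 b).2)) ?_ ?_
        · intro p hp
          simpa using hp
        · rintro ⟨w, w'⟩ _ ⟨z, z'⟩ _ h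
          simp only [Prod.mk.injEq] at h
          refine Prod.ext (funext fun b => Prod.ext ?_ ?_) (funext fun b => Prod.ext ?_ ?_)
          · simpa using congrFun h.1 (Sum.inl b)
          · simpa using congrFun h.2 (Sum.inl b)
          · simpa using congrFun h.1 (Sum.inr b)
          · simpa using congrFun h.2 (Sum.inr b)
    _ ≤ _ := by
        rw [Finset.card_product, Finset.card_univ, Fintype.card_fun, Fintype.card_sum, ← two_mul]
        exact Nat.mul_le_mul_right _ h

end PairCounting

section Independence

variable {Ω : Type*} [MeasurableSpace Ω] {P : Measure Ω} {d : ℕ}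

/-- A product of entries of independent matrices has mean zero if one of the matrices contributes
a single, centred factor. -/
theorem integral_prod_entries_eq_zero {β π : Type*} [Fintype β] [DecidableEq β] [Fintype π]
    [DecidableEq π] {X : π → Ω → Matrix (Fin d) (Fin d) ℝ} (hX : iIndepFun X P)
    (hmeas : ∀ p, Measurable (X p)) (q : β → π) (a b : β → Fin d) (i₀ : β)
    (hne : ∀ j, j ≠ i₀ → q j ≠ q i₀) (h0 : ∫ ω, X (q i₀) ω (a i₀) (b i₀) ∂P = 0) :
    ∫ ω, ∏ i, X (q i) ω (a i) (b i) ∂P = 0 := by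
  have hind := hX.indepFun_finset {q i₀} (Finset.univ.erase (q i₀)) (by simp) hmeas
  have hφ : Measurable fun Y : ({q i₀} : Finset π) → Matrix (Fin d) (Fin d) ℝ =>
      Y ⟨q i₀, by simp⟩ (a i₀) (b i₀) := by fun_prop
  have hψ : Measurable fun Y : (Finset.univ.erase (q i₀) : Finset π) → Matrix (Fin d) (Fin d) ℝ =>
      ∏ j : {j // j ≠ i₀}, Y ⟨q j, by simpa using hne j j.2⟩ (a j) (b j) := by fun_prop
  have h := (hind.comp hφ hψ).integral_fun_mul_eq_mul_integral
    ((hφ.comp (by fun_prop)).aestronglyMeasurable) ((hψ.comp (by fun_prop)).aestronglyMeasurable)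
  simp only [Function.comp_def] at h
  rw [h0, zero_mul] at h
  rw [← h]
  refine integral_congr_ae (ae_of_all _ fun ω => ?_)
  simp only
  rw [← Finset.mul_prod_erase _ _ (Finset.mem_univ i₀)]
  congr 1
  exact Finset.prod_subtype (p := fun j => j ≠ i₀) _ (by simp) _

end Independence

section OffDiagonal

variable {n d : ℕ}

/-- The off-diagonal part of a block matrix: the diagonal blocks are replaced by `0`. -/
def offDiagPart (A : Matrix (Fin n × Fin d) (Fin n × Fin d) ℝ) :
    Matrix (Fin n × Fin d) (Fin n × Fin d) ℝ :=
  Matrix.of fun p q => if p.1 = q.1 then 0 else A p q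

theorem offDiagPart_apply_of_ne (A : Matrix (Fin n × Fin d) (Fin n × Fin d) ℝ)
    {p q : Fin n × Fin d} (h : p.1 ≠ q.1) : offDiagPart A p q = A p q := by
  simp [offDiagPart, h]

theorem offDiagPart_apply_of_eq (A : Matrix (Fin n × Fin d) (Fin n × Fin d) ℝ)
    {p q : Fin n × Fin d} (h : p.1 = q.1) : offDiagPart A p q = 0 := by
  simp [offDiagPart, h]

theorem offDiagPart_add_blockDiagPart (A : Matrix (Fin n × Fin d) (Fin n × Fin d) ℝ) :
    offDiagPart A + blockDiagPart A = A := by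
  ext p q
  by_cases h : p.1 = q.1 <;> simp [offDiagPart, blockDiagPart, h]

theorem isHermitian_offDiagPart {A : Matrix (Fin n × Fin d) (Fin n × Fin d) ℝ}
    (hA : A.IsHermitian) : (offDiagPart A).IsHermitian := by
  ext p q
  have := hA.apply p q
  by_cases h : p.1 = q.1
  · simp [offDiagPart, h]
  · simpa [offDiagPart, h, Ne.symm h] using this

theorem measurable_offDiagPart :
    Measurable (offDiagPart : Matrix (Fin n × Fin d) (Fin n × Fin d) ℝ → _) := by
  refine measurable_pi_lambda _ fun p => measurable_pi_lambda _ fun q => ?_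
  by_cases h : p.1 = q.1
  · simp only [offDiagPart, Matrix.of_apply, h, if_true, measurable_const]
  · simp only [offDiagPart, Matrix.of_apply, h, if_false]
    fun_prop

/-- The blocks of `A` strictly above the diagonal are orthogonal. -/
def HasOrthogonalBlocks (A : Matrix (Fin n × Fin d) (Fin n × Fin d) ℝ) : Prop :=
  ∀ i j, i < j → block A i j * (block A i j).transpose = 1

theorem HasOrthogonalBlocks.hasInverseBlocks {A : Matrix (Fin n × Fin d) (Fin n × Fin d) ℝ}
    (h : HasOrthogonalBlocks A) (hA : A.IsHermitian) : HasInverseBlocks (offDiagPart A) where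
  diag _ _ hxy := offDiagPart_apply_of_eq A hxy
  inv i j hij a b := by
    have h1 : ∀ c, offDiagPart A (i, a) (j, c) * offDiagPart A (j, c) (i, b) =
        A (i, a) (j, c) * A (i, b) (j, c) := by
      intro c
      rw [offDiagPart_apply_of_ne A hij, offDiagPart_apply_of_ne A hij.symm]
      congr 1
      simpa using (hA.apply (j, c) (i, b)).symm
    rw [Finset.sum_congr rfl fun c _ => h1 c]
    rcases lt_or_gt_of_ne hij with hlt | hgt
    · have := congrFun (congrFun (h i j hlt) a) b
      simpa [Matrix.mul_apply, block, Matrix.one_apply] using this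
    · have h2 : (block A j i).transpose * block A j i = 1 := mul_eq_one_comm.1 (h j i hgt)
      have := congrFun (congrFun h2 a) b
      have hs : ∀ x y, A x y = A y x := fun x y => by simpa using (hA.apply x y).symm
      simpa [Matrix.mul_apply, block, Matrix.one_apply, hs (i, _)] using this

theorem HasOrthogonalBlocks.abs_offDiagPart_le
    {A : Matrix (Fin n × Fin d) (Fin n × Fin d) ℝ}
    (h : HasOrthogonalBlocks A) (hA : A.IsHermitian) (x y : Fin n × Fin d) :
    |offDiagPart A x y| ≤ 1 := by
  by_cases hxy : x.1 = y.1
  · rw [offDiagPart_apply_of_eq A hxy, abs_zero]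
    exact zero_le_one
  rw [offDiagPart_apply_of_ne A hxy]
  rcases lt_or_gt_of_ne hxy with hlt | hgt
  · exact abs_apply_le_one_of_mul_transpose (h _ _ hlt) x.2 y.2
  · rw [show A x y = A y x by simpa using (hA.apply x y).symm]
    exact abs_apply_le_one_of_mul_transpose (h _ _ hgt) y.2 x.2

end OffDiagonal

section SecondMoment

variable {Ω : Type*} [MeasurableSpace Ω] {P : Measure Ω} {n d : ℕ}

theorem measurable_block (i j : Fin n) :
    Measurable fun A : Matrix (Fin n × Fin d) (Fin n × Fin d) ℝ => block A i j :=
  measurable_pi_lambda _ fun a => measurable_pi_lambda _ fun b => by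
    simp only [block, Matrix.of_apply]
    fun_prop

/-- An off-diagonal entry of a symmetric block matrix is an entry of a block above the diagonal. -/
theorem exists_eq_block_apply {x y : Fin n × Fin d} (hxy : x.1 ≠ y.1) :
    ∃ (p : {p : Fin n × Fin n // p.1 < p.2}) (a b : Fin d), s(x.1, y.1) = s(p.1.1, p.1.2) ∧
      ∀ A : Matrix (Fin n × Fin d) (Fin n × Fin d) ℝ, A.IsHermitian →
        A x y = block A p.1.1 p.1.2 a b := by
  rcases lt_or_gt_of_ne hxy with h | h
  · exact ⟨⟨(x.1, y.1), h⟩, x.2, y.2, rfl, fun A _ => rfl⟩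
  · exact ⟨⟨(y.1, x.1), h⟩, y.2, x.2, Sym2.eq_swap, fun A hA => by
      rw [← hA.apply x y]
      rfl⟩

/-- A product of off-diagonal entries of a random block matrix with independent centred blocks has
mean zero unless the block position of each factor is shared by another factor. -/
theorem integral_prod_offDiagPart_eq_zero
    {M : Ω → Matrix (Fin n × Fin d) (Fin n × Fin d) ℝ} (hmeas : Measurable M)
    (hherm : ∀ ω, (M ω).IsHermitian)
    (hmean : ∀ i j, i < j → ∀ a b, ∫ ω, block (M ω) i j a b ∂P = 0)
    (hindep : iIndepFun
      (fun (p : {p : Fin n × Fin n // p.1 < p.2}) ω => block (M ω) p.1.1 p.1.2) P)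
    {β : Type*} [Fintype β] [DecidableEq β] (x y : β → Fin n × Fin d)
    (hne : ∀ i, (x i).1 ≠ (y i).1) (i₀ : β)
    (h0 : ∀ j, j ≠ i₀ → s((x j).1, (y j).1) ≠ s((x i₀).1, (y i₀).1)) :
    ∫ ω, ∏ i, offDiagPart (M ω) (x i) (y i) ∂P = 0 := by
  choose q a b hq hent using fun i => exists_eq_block_apply (hne i)
  have h := integral_prod_entries_eq_zero hindep
    (fun p => (measurable_block p.1.1 p.1.2).comp hmeas) q a b i₀
    (fun j hj hqj => h0 j hj (by rw [hq j, hq i₀, hqj])) (hmean _ _ (q i₀).2 _ _)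
  rw [← h]
  refine integral_congr_ae (ae_of_all _ fun ω => Finset.prod_congr rfl fun i _ => ?_)
  rw [offDiagPart_apply_of_ne _ (hne i), hent i _ (hherm ω)]

/-- The periodic extension of the walk of blocks of a closed walk. -/
def blockWalk {k : ℕ} (w : Fin (k + 1) → Fin n × Fin d) (t : ℕ) : Fin n :=
  (w (Fin.ofNat (k + 1) (t % k))).1

theorem blockWalk_periodic {k : ℕ} (w : Fin (k + 1) → Fin n × Fin d) :
    Function.Periodic (blockWalk w) k := by
  intro t
  simp [blockWalk]

theorem blockWalk_eq {k : ℕ} {w : Fin (k + 1) → Fin n × Fin d} (hw : w (Fin.last k) = w 0)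
    (t : Fin (k + 1)) : blockWalk w t = (w t).1 := by
  rcases Fin.eq_castSucc_or_eq_last t with ⟨s, rfl⟩ | rfl
  · rw [blockWalk]
    congr 2
    ext
    simp [Fin.ofNat, Nat.mod_eq_of_lt s.2, Nat.mod_eq_of_lt (s.2.trans (Nat.lt_succ_self k))]
  · rw [hw, blockWalk]
    congr 2
    ext
    simp

/-- If two closed nonbacktracking walks of length `k` visit more than `k` blocks, then the product
of the matrix entries along them has mean zero: either a step stays in its block, or some pair of
blocks is traversed exactly once. -/
theorem integral_walk_products_eq_zero
    {M : Ω → Matrix (Fin n × Fin d) (Fin n × Fin d) ℝ} (hmeas : Measurable M)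
    (hherm : ∀ ω, (M ω).IsHermitian)
    (hmean : ∀ i j, i < j → ∀ a b, ∫ ω, block (M ω) i j a b ∂P = 0)
    (hindep : iIndepFun
      (fun (p : {p : Fin n × Fin n // p.1 < p.2}) ω => block (M ω) p.1.1 p.1.2) P)
    {k : ℕ} (hk : 0 < k) {w w' : Fin (k + 1) → Fin n × Fin d}
    (hw : w (Fin.last k) = w 0) (hw' : w' (Fin.last k) = w' 0)
    (hnb : IsNonbacktracking k (w 0).1 w) (hnb' : IsNonbacktracking k (w' 0).1 w')
    (hcard : k <
      (Finset.univ.image (Sum.elim (fun b => (w b).1) fun b => (w' b).1)).card) :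
    ∫ ω, (∏ t : Fin k, offDiagPart (M ω) (w t.castSucc) (w t.succ)) *
      ∏ t : Fin k, offDiagPart (M ω) (w' t.castSucc) (w' t.succ) ∂P = 0 := by
  set x : Fin k ⊕ Fin k → Fin n × Fin d :=
    Sum.elim (fun t => w t.castSucc) (fun t => w' t.castSucc) with hx
  set y : Fin k ⊕ Fin k → Fin n × Fin d :=
    Sum.elim (fun t => w t.succ) (fun t => w' t.succ) with hy
  have hprod : ∀ ω, (∏ t : Fin k, offDiagPart (M ω) (w t.castSucc) (w t.succ)) *
      ∏ t : Fin k, offDiagPart (M ω) (w' t.castSucc) (w' t.succ) =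
      ∏ i, offDiagPart (M ω) (x i) (y i) := by
    intro ω
    simp [hx, hy]
  simp only [hprod]
  by_cases hne : ∀ i, (x i).1 ≠ (y i).1
  swap
  · push Not at hne
    obtain ⟨i, hi⟩ := hne
    have : ∀ ω, ∏ i, offDiagPart (M ω) (x i) (y i) = 0 := fun ω =>
      Finset.prod_eq_zero (Finset.mem_univ i) (offDiagPart_apply_of_eq _ hi)
    simp [this]
  by_cases htwice : ∀ i, ∃ j, j ≠ i ∧ s((x j).1, (y j).1) = s((x i).1, (y i).1)
  swap
  · push Not at htwice
    obtain ⟨i₀, hi₀⟩ := htwice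
    exact integral_prod_offDiagPart_eq_zero hmeas hherm hmean hindep x y hne i₀ hi₀
  exfalso
  have hstep : ∀ {v : Fin (k + 1) → Fin n × Fin d}, v (Fin.last k) = v 0 → ∀ t : Fin k,
      blockWalk v t = (v t.castSucc).1 ∧ blockWalk v (t + 1) = (v t.succ).1 := fun hv t =>
    ⟨by simpa using blockWalk_eq hv t.castSucc, by simpa using blockWalk_eq hv t.succ⟩
  have hnb2 : ∀ {v : Fin (k + 1) → Fin n × Fin d}, v (Fin.last k) = v 0 →
      IsNonbacktracking k (v 0).1 v → ∀ t, t + 2 ≤ k → blockWalk v (t + 2) ≠ blockWalk v t := by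
    intro v hv h t ht
    have h1 := blockWalk_eq hv ⟨t + 2, by omega⟩
    have h2 := blockWalk_eq hv ⟨t, by omega⟩
    simp only at h1 h2
    rw [h1, h2]
    exact h.apply_ne t (by omega)
  have hle := card_walkVertices_union_le_length hk (blockWalk_periodic w) (blockWalk_periodic w')
    (fun t ht => by
      obtain ⟨h1, h2⟩ := hstep hw ⟨t, ht⟩
      simp only at h1 h2
      rw [h1, h2]
      exact hne (Sum.inl ⟨t, ht⟩)) (hnb2 hw hnb)
    (fun t ht => by
      obtain ⟨h1, h2⟩ := hstep hw' ⟨t, ht⟩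
      simp only at h1 h2
      rw [h1, h2]
      exact hne (Sum.inr ⟨t, ht⟩)) (hnb2 hw' hnb')
    (e := fun i => s((x i).1, (y i).1))
    (by
      ext i
      rcases i with t | t
      · simp [hx, hy, (hstep hw t).1, (hstep hw t).2]
      · simp [hx, hy, (hstep hw' t).1, (hstep hw' t).2]) htwice
  refine absurd (le_trans (Finset.card_le_card ?_) hle) (not_le.2 hcard)
  have hmem : ∀ (v : Fin (k + 1) → Fin n × Fin d), v (Fin.last k) = v 0 → ∀ t,
      (v t).1 ∈ walkVertices (blockWalk v) k := by
    intro v hv t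
    rw [← blockWalk_eq hv t]
    exact Finset.mem_image.2 ⟨t % k, Finset.mem_range.2 (Nat.mod_lt _ hk),
      (blockWalk_periodic v).map_mod_nat _⟩
  intro i hi
  obtain ⟨t | t, _, rfl⟩ := Finset.mem_image.1 hi
  · exact Finset.mem_union_left _ (hmem w hw t)
  · exact Finset.mem_union_right _ (hmem w' hw' t)

theorem measurable_walk_product {M : Ω → Matrix (Fin n × Fin d) (Fin n × Fin d) ℝ}
    (hmeas : Measurable M) {k : ℕ} (w : Fin (k + 1) → Fin n × Fin d) :
    Measurable fun ω => ∏ t : Fin k, offDiagPart (M ω) (w t.castSucc) (w t.succ) := by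
  have := measurable_offDiagPart.comp hmeas
  simp only [Function.comp_def] at this
  fun_prop

/-- The trace of the `k`-th nonbacktracking matrix has second moment of order `n ^ k`: this is the
number of pairs of walks that visit at most `k` blocks. -/
theorem integral_trace_nbMatrix_sq_le [IsProbabilityMeasure P] [Nonempty (Fin n)]
    {M : Ω → Matrix (Fin n × Fin d) (Fin n × Fin d) ℝ} (hmeas : Measurable M)
    (hherm : ∀ ω, (M ω).IsHermitian) (horth : ∀ᵐ ω ∂P, HasOrthogonalBlocks (M ω))
    (hmean : ∀ i j, i < j → ∀ a b, ∫ ω, block (M ω) i j a b ∂P = 0)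
    (hindep : iIndepFun
      (fun (p : {p : Fin n × Fin n // p.1 < p.2}) ω => block (M ω) p.1.1 p.1.2) P)
    {k : ℕ} (hk : 0 < k) :
    Integrable (fun ω => (nbMatrix (offDiagPart (M ω)) k).trace ^ 2) P ∧
    ∫ ω, (nbMatrix (offDiagPart (M ω)) k).trace ^ 2 ∂P ≤
      (n : ℝ) ^ k * ((k : ℝ) ^ (2 * (k + 1)) * (d : ℝ) ^ (2 * (k + 1))) := by
  classical
  set f : (Fin (k + 1) → Fin n × Fin d) → Ω → ℝ := fun w ω =>
    ∏ t : Fin k, offDiagPart (M ω) (w t.castSucc) (w t.succ) with hf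
  set W : Finset (Fin (k + 1) → Fin n × Fin d) :=
    Finset.univ.filter fun w => w (Fin.last k) = w 0 ∧ IsNonbacktracking k (w 0).1 w with hW
  have hbound : ∀ w, ∀ᵐ ω ∂P, |f w ω| ≤ 1 := by
    intro w
    filter_upwards [horth] with ω h
    rw [hf, Finset.abs_prod]
    exact Finset.prod_le_one (fun _ _ => abs_nonneg _) fun _ _ => h.abs_offDiagPart_le (hherm ω) _ _
  have hbound2 : ∀ w w', ∀ᵐ ω ∂P, ‖f w ω * f w' ω‖ ≤ 1 := by
    intro w w'
    filter_upwards [hbound w, hbound w'] with ω h h'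
    rw [norm_mul]
    exact mul_le_one₀ h (norm_nonneg _) h'
  have hint : ∀ w w', Integrable (fun ω => f w ω * f w' ω) P := fun w w' =>
    Integrable.of_bound ((measurable_walk_product hmeas w).mul
      (measurable_walk_product hmeas w')).aestronglyMeasurable 1 (hbound2 w w')
  have hsq : ∀ ω, (nbMatrix (offDiagPart (M ω)) k).trace ^ 2 =
      ∑ w ∈ W, ∑ w' ∈ W, f w ω * f w' ω := by
    intro ω
    rw [trace_nbMatrix_eq_sum, ← Finset.sum_filter, sq, Finset.sum_mul_sum]
  simp only [hsq]
  refine ⟨integrable_finsetSum _ fun w _ => integrable_finsetSum _ fun w' _ => hint w w', ?_⟩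
  rw [integral_finsetSum _ fun w _ => integrable_finsetSum _ fun w' _ => hint w w']
  simp only [integral_finsetSum _ fun w' _ => hint _ w']
  set G : Finset ((Fin (k + 1) → Fin n × Fin d) × (Fin (k + 1) → Fin n × Fin d)) :=
    Finset.univ.filter fun p =>
      (Finset.univ.image (Sum.elim (fun b => (p.1 b).1) fun b => (p.2 b).1)).card ≤ k with hG
  have hterm : ∀ w ∈ W, ∀ w' ∈ W,
      ∫ ω, f w ω * f w' ω ∂P ≤ if (w, w') ∈ G then 1 else 0 := by
    intro w hw w' hw'
    rw [hW, Finset.mem_filter] at hw hw'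
    split_ifs with h
    · calc ∫ ω, f w ω * f w' ω ∂P ≤ ∫ _, (1 : ℝ) ∂P := by
            refine integral_mono_ae (hint w w') (integrable_const _) ?_
            filter_upwards [hbound2 w w'] with ω h using (le_abs_self _).trans h
        _ = 1 := by simp
    · rw [hG, Finset.mem_filter, not_and, not_le] at h
      exact (integral_walk_products_eq_zero hmeas hherm hmean hindep hk hw.2.1 hw'.2.1 hw.2.2
        hw'.2.2 (h (Finset.mem_univ _))).le
  calc ∑ w ∈ W, ∑ w' ∈ W, ∫ ω, f w ω * f w' ω ∂P
      ≤ ∑ w ∈ W, ∑ w' ∈ W, (if (w, w') ∈ G then 1 else 0 : ℝ) :=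
        Finset.sum_le_sum fun w hw => Finset.sum_le_sum fun w' hw' => hterm w hw w' hw'
    _ = ∑ p ∈ W ×ˢ W, (if p ∈ G then 1 else 0 : ℝ) := by rw [Finset.sum_product]
    _ ≤ ∑ p, (if p ∈ G then 1 else 0 : ℝ) :=
        Finset.sum_le_sum_of_subset_of_nonneg (Finset.subset_univ _) fun _ _ _ => by
          split_ifs <;> norm_num
    _ = (G.card : ℝ) := by simp
    _ ≤ _ := by
        have := card_filter_pair_le (β := Fin (k + 1)) (ι := Fin n) (κ := Fin d) k
        simp only [Fintype.card_fin] at this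
        rw [← mul_assoc]
        exact_mod_cast this

end SecondMoment

/-! ### Spectral distributions and the semicircle law -/

section SpectralDistribution

variable {ι : Type*} [Fintype ι] [DecidableEq ι] {A : Matrix ι ι ℝ}

theorem integral_spectralDistribution (hA : A.IsHermitian) (f : ℝ → ℝ) :
    ∫ x, f x ∂spectralDistribution hA = (Fintype.card ι : ℝ)⁻¹ * ∑ i, f (hA.eigenvalues i) := by
  rw [spectralDistribution, integral_smul_measure,
    integral_finsetSum_measure fun i _ => integrable_dirac (by simp)]
  simp

theorem isProbabilityMeasure_spectralDistribution [Nonempty ι] (hA : A.IsHermitian) :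
    IsProbabilityMeasure (spectralDistribution hA) := by
  constructor
  simp [spectralDistribution, ENNReal.inv_mul_cancel]

theorem trace_pow_eq_sum_eigenvalues (hA : A.IsHermitian) (k : ℕ) :
    (A ^ k).trace = ∑ i, hA.eigenvalues i ^ k := by
  conv_lhs =>
    rw [hA.spectral_theorem, ← map_pow, Unitary.conjStarAlgAut_apply, Matrix.trace_mul_cycle]
  rw [Unitary.coe_star_mul_self, one_mul, Matrix.diagonal_pow, Matrix.trace_diagonal]
  simp

open Polynomial in
theorem sum_eval_eigenvalues (hA : A.IsHermitian) (q : ℝ[X]) :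
    ∑ i, q.eval (hA.eigenvalues i) = (aeval A q).trace := by
  induction q using Polynomial.induction_on' with
  | add p q hp hq => simp [Finset.sum_add_distrib, hp, hq]
  | monomial k a =>
    simp only [eval_monomial, aeval_monomial, ← Algebra.smul_def, Matrix.trace_smul,
      trace_pow_eq_sum_eigenvalues hA, Finset.mul_sum, smul_eq_mul]

end SpectralDistribution

section Semicircle

open Polynomial Chebyshev

/-- The substitution `x = 2 * y` turns the semicircle law into the weight `1 - y ^ 2` with respect
to the measure `measureT`, for which the Chebyshev polynomials `T` are orthogonal. -/
theorem integral_semicircle (f : ℝ → ℝ) :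
    ∫ x, f x ∂semicircle = 2 / Real.pi * ∫ y, f (2 * y) * (1 - y ^ 2) ∂measureT := by
  have h1 : ∫ x, f x ∂semicircle =
      ∫ x in (-2)..2, Real.sqrt (4 - x ^ 2) / (2 * Real.pi) * f x := by
    rw [semicircle, integral_withDensity_eq_integral_toReal_smul (by fun_prop) (by simp),
      intervalIntegral.integral_of_le (by norm_num)]
    rw [setIntegral_eq_integral_of_forall_compl_eq_zero]
    · refine integral_congr_ae (ae_of_all _ fun x => ?_)
      simp only [smul_eq_mul]
      rw [ENNReal.toReal_ofReal (by positivity)]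
    · intro x hx
      have : 4 - x ^ 2 ≤ 0 := by
        rw [Set.mem_Ioc, not_and_or] at hx
        rcases hx with h | h <;> nlinarith
      rw [Real.sqrt_eq_zero_of_nonpos this]
      simp
  have h2 := intervalIntegral.integral_comp_mul_left (a := -1) (b := 1)
    (fun x => Real.sqrt (4 - x ^ 2) / (2 * Real.pi) * f x) (two_ne_zero (α := ℝ))
  rw [show (2 : ℝ) * -1 = -2 by norm_num, mul_one, smul_eq_mul, ← h1,
    eq_inv_mul_iff_mul_eq₀ two_ne_zero] at h2
  rw [← h2, integral_measureT, ← intervalIntegral.integral_const_mul,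
    ← intervalIntegral.integral_const_mul]
  refine intervalIntegral.integral_congr fun y _ => ?_
  have h3 : Real.sqrt (4 - (2 * y) ^ 2) = 2 * Real.sqrt (1 - y ^ 2) := by
    rw [show 4 - (2 * y) ^ 2 = 2 ^ 2 * (1 - y ^ 2) by ring, Real.sqrt_mul (by norm_num),
      Real.sqrt_sq (by norm_num)]
  simp only [h3, Real.sqrt_inv]
  rcases le_or_gt (1 - y ^ 2) 0 with hy | hy
  · rw [Real.sqrt_eq_zero_of_nonpos hy]
    simp
  · have h4 : (1 - y ^ 2) * (Real.sqrt (1 - y ^ 2))⁻¹ = Real.sqrt (1 - y ^ 2) := by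
      rw [← div_eq_mul_inv, Real.div_sqrt]
    rw [mul_assoc (f (2 * y)), h4]
    field_simp

/-- The polynomials `S n`, `n ≥ 1`, are orthogonal to constants with respect to the semicircle law,
because `(1 - y ^ 2) * S n (2 * y)` is half the difference of `T n` and `T (n + 2)`. -/
theorem integral_eval_S_semicircle (n : ℕ) :
    ∫ x, (S ℝ (n : ℤ)).eval x ∂semicircle = if n = 0 then 1 else 0 := by
  have h : ∀ y : ℝ, (S ℝ (n : ℤ)).eval (2 * y) * (1 - y ^ 2) =
      ((T ℝ (n : ℤ)).eval y - (T ℝ ((n : ℤ) + 2)).eval y) / 2 := by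
    intro y
    have h1 := congrArg (Polynomial.eval y) (one_sub_X_sq_mul_U_eq_pol_in_T ℝ (n : ℤ))
    have h2 := congrArg (Polynomial.eval y) (T_add_two ℝ (n : ℤ))
    have h3 := congrArg (Polynomial.eval y) (S_comp_two_mul_X ℝ (n : ℤ))
    simp only [eval_mul, eval_sub, eval_one, eval_pow, eval_X, eval_comp, eval_ofNat] at h1 h2 h3
    rw [h3]
    linarith
  have hT : ∀ m : ℤ, Integrable (fun y => (T ℝ m).eval y) measureT := fun m =>
    integrable_measureT (by fun_prop)
  rw [integral_semicircle]
  simp only [h]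
  rw [integral_div, integral_sub (hT _) (hT _),
    integral_eval_T_real_measureT_of_ne_zero (n := (n : ℤ) + 2) (by positivity)]
  split_ifs with hn
  · subst hn
    rw [Nat.cast_zero, integral_eval_T_real_measureT_zero]
    field_simp
    norm_num
  · rw [integral_eval_T_real_measureT_of_ne_zero (by exact_mod_cast hn)]
    simp

instance isProbabilityMeasure_semicircle : IsProbabilityMeasure semicircle := by
  have h := integral_eval_S_semicircle 0
  simp only [Nat.cast_zero, S_zero, eval_one, integral_const, smul_eq_mul, mul_one, if_true,
    Measure.real, ENNReal.toReal_eq_one_iff] at h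
  exact ⟨h⟩

theorem ae_semicircle_mem_Icc : ∀ᵐ x ∂semicircle, x ∈ Set.Icc (-2 : ℝ) 2 := by
  rw [semicircle, ae_withDensity_iff (by fun_prop)]
  refine ae_of_all _ fun x hx => ?_
  by_contra hmem
  refine hx ?_
  have : 4 - x ^ 2 ≤ 0 := by
    rw [Set.mem_Icc, not_and_or] at hmem
    rcases hmem with h | h <;> nlinarith
  rw [Real.sqrt_eq_zero_of_nonpos this]
  simp

theorem integrable_semicircle {f : ℝ → ℝ} (hf : Continuous f) : Integrable f semicircle := by
  obtain ⟨C, hC⟩ := isCompact_Icc.exists_bound_of_continuousOn (s := Set.Icc (-2 : ℝ) 2)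
    hf.continuousOn
  refine Integrable.of_bound hf.aestronglyMeasurable C ?_
  filter_upwards [ae_semicircle_mem_Icc] with x hx using hC x hx

/-- The polynomials `S n` span all polynomials: their span contains `1` and, by the recurrence, is
stable under multiplication by `X`. -/
theorem submodule_eq_top_of_forall_S_mem {T : Submodule ℝ ℝ[X]}
    (hT : ∀ n : ℕ, S ℝ (n : ℤ) ∈ T) : T = ⊤ := by
  set N : Submodule ℝ ℝ[X] := Submodule.span ℝ (Set.range fun n : ℕ => S ℝ (n : ℤ)) with hN
  have hNT : N ≤ T := Submodule.span_le.2 (by rintro _ ⟨n, rfl⟩; exact hT n)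
  have hmem : ∀ n : ℕ, S ℝ (n : ℤ) ∈ N := fun n => Submodule.subset_span ⟨n, rfl⟩
  have hX : ∀ p ∈ N, X * p ∈ N := by
    intro p hp
    induction hp using Submodule.span_induction with
    | mem p hp =>
      obtain ⟨n, rfl⟩ := hp
      have h := S_add_one ℝ (n : ℤ)
      simp only
      rw [show X * S ℝ (n : ℤ) = S ℝ ((n : ℤ) + 1) + S ℝ ((n : ℤ) - 1) by rw [h]; ring]
      refine N.add_mem (by exact_mod_cast hmem (n + 1)) ?_
      cases n with
      | zero => simp
      | succ n => simpa using hmem n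
    | zero => simp
    | add p q _ _ hp hq => rw [mul_add]; exact N.add_mem hp hq
    | smul a p _ hp => rw [mul_smul_comm]; exact N.smul_mem a hp
  have hpow : ∀ k : ℕ, (X : ℝ[X]) ^ k ∈ N := by
    intro k
    induction k with
    | zero => simpa using hmem 0
    | succ k ih => rw [pow_succ']; exact hX _ ih
  rw [eq_top_iff]
  intro p _
  refine hNT ?_
  rw [p.as_sum_range_C_mul_X_pow]
  refine N.sum_mem fun k _ => ?_
  rw [← smul_eq_C_mul]
  exact N.smul_mem _ (hpow k)

/-- If the normalized traces of all Chebyshev polynomials `S k`, `k ≥ 1`, tend to `0`, then the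
normalized traces of all polynomials tend to the moments of the semicircle law. -/
theorem tendsto_polynomial_of_tendsto_S {L : ℕ → ℝ[X] →ₗ[ℝ] ℝ}
    (h0 : Tendsto (fun n => L n 1) atTop (𝓝 1))
    (hS : ∀ k : ℕ, Tendsto (fun n => L n (S ℝ ((k : ℤ) + 1))) atTop (𝓝 0)) (q : ℝ[X]) :
    Tendsto (fun n => L n q) atTop (𝓝 (∫ x, q.eval x ∂semicircle)) := by
  have hint : ∀ p : ℝ[X], Integrable (fun x => p.eval x) semicircle := fun p =>
    integrable_semicircle p.continuous
  let T : Submodule ℝ ℝ[X] :=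
    { carrier := {p | Tendsto (fun n => L n p) atTop (𝓝 (∫ x, p.eval x ∂semicircle))}
      zero_mem' := by simp
      add_mem' := by
        intro p r hp hr
        simp only [Set.mem_ofPred_eq, map_add, eval_add] at hp hr ⊢
        rw [integral_add (hint p) (hint r)]
        exact hp.add hr
      smul_mem' := by
        intro a p hp
        simp only [Set.mem_ofPred_eq, map_smul, eval_smul, smul_eq_mul] at hp ⊢
        rw [integral_const_mul]
        exact hp.const_mul a }
  have hT : T = ⊤ := submodule_eq_top_of_forall_S_mem fun n => by
    change Tendsto _ _ _
    rw [integral_eval_S_semicircle]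
    cases n with
    | zero => simpa using h0
    | succ n => simpa using hS n
  have : q ∈ T := hT ▸ Submodule.mem_top
  exact this

end Semicircle

/-! ### Convergence of the moments of the off-diagonal part -/

section ScaledSemicircle

variable (c : ℝ)

instance isProbabilityMeasure_scaledSemicircle : IsProbabilityMeasure (scaledSemicircle c) :=
  Measure.isProbabilityMeasure_map (by fun_prop)

theorem integral_scaledSemicircle {f : ℝ → ℝ} (hf : Continuous f) :
    ∫ x, f x ∂scaledSemicircle c = ∫ x, f (c * x) ∂semicircle := by
  rw [scaledSemicircle, integral_map (by fun_prop) hf.aestronglyMeasurable]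

theorem integrable_scaledSemicircle {f : ℝ → ℝ} (hf : Continuous f) :
    Integrable f (scaledSemicircle c) := by
  rw [scaledSemicircle, integrable_map_measure hf.aestronglyMeasurable (by fun_prop)]
  exact integrable_semicircle (by fun_prop)

end ScaledSemicircle

section BorelCantelli

variable {Ω : Type*} [MeasurableSpace Ω] {P : Measure Ω}

/-- A Borel–Cantelli argument: almost surely the sum of the `Z n` is finite. -/
theorem ae_tendsto_zero_of_summable_integral {Z : ℕ → Ω → ℝ} (hZ : ∀ n ω, 0 ≤ Z n ω)
    (hint : ∀ n, Integrable (Z n) P) {c : ℕ → ℝ} (hc : Summable c)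
    (hle : ∀ n, ∫ ω, Z n ω ∂P ≤ c n) :
    ∀ᵐ ω ∂P, Tendsto (fun n => Z n ω) atTop (𝓝 0) := by
  have hfin : ∫⁻ ω, ∑' n, ENNReal.ofReal (Z n ω) ∂P ≠ ⊤ := by
    rw [lintegral_tsum fun n => (hint n).aemeasurable.ennreal_ofReal]
    have h : ∀ n, ∫⁻ ω, ENNReal.ofReal (Z n ω) ∂P ≤ ENNReal.ofReal (c n) := fun n => by
      rw [← ofReal_integral_eq_lintegral_ofReal (hint n) (ae_of_all _ (hZ n))]
      exact ENNReal.ofReal_le_ofReal (hle n)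
    refine ne_top_of_le_ne_top ?_ (ENNReal.tsum_le_tsum h)
    exact hc.tsum_ofReal_ne_top
  filter_upwards [ae_lt_top' (AEMeasurable.tsum fun n =>
    (hint n).aemeasurable.ennreal_ofReal) hfin] with ω hω
  have h := ENNReal.tendsto_atTop_zero_of_tsum_ne_top hω.ne
  have h2 := (ENNReal.tendsto_toReal ENNReal.zero_ne_top).comp h
  simpa [Function.comp_def, ENNReal.toReal_ofReal (hZ _ ω)] using h2

end BorelCantelli

section Moments

open Polynomial Chebyshev

variable {Ω : Type*} [MeasurableSpace Ω] {P : Measure Ω} {d : ℕ}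
  {ν : Measure (Matrix (Fin d) (Fin d) ℝ)}
  {M : (n : ℕ) → Ω → Matrix (Fin n × Fin d) (Fin n × Fin d) ℝ}

theorem IsBlockModel.ae_hasOrthogonalBlocks (hM : IsBlockModel P ν M) (hν : IsOrthogonalLaw ν) :
    ∀ᵐ ω ∂P, ∀ n, HasOrthogonalBlocks (M n ω) := by
  rw [ae_all_iff]
  intro n
  have h : ∀ i j : Fin n, ∀ᵐ ω ∂P, i < j →
      block (M n ω) i j * (block (M n ω) i j).transpose = 1 := by
    intro i j
    by_cases hij : i < j
    · filter_upwards [hν.ae_mul_transpose (hM.hasLaw n i j hij)] with ω hω _ using hω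
    · exact ae_of_all _ fun ω h => absurd h hij
  filter_upwards [ae_all_iff.2 fun i => ae_all_iff.2 (h i)] with ω hω using hω

theorem IsBlockModel.integral_block_eq_zero (hM : IsBlockModel P ν M) (hν : IsOrthogonalLaw ν)
    {n : ℕ} (i j : Fin n) (hij : i < j) (a b : Fin d) :
    ∫ ω, block (M n ω) i j a b ∂P = 0 :=
  hν.integral_entry_eq_zero (hM.hasLaw n i j hij) a b

/-- Almost surely, the normalized traces of the nonbacktracking matrices tend to `0`: their second
moments are of order `1 / n ^ 2`. -/
theorem IsBlockModel.ae_tendsto_trace_nbMatrix [IsProbabilityMeasure P] (hM : IsBlockModel P ν M)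
    (hν : IsOrthogonalLaw ν) (k : ℕ) :
    ∀ᵐ ω ∂P, Tendsto (fun n : ℕ => (((n + 3 : ℕ) : ℝ) * d)⁻¹ *
      ((Real.sqrt (n + 1)) ^ (k + 1))⁻¹ *
      (nbMatrix (offDiagPart (M (n + 3) ω)) (k + 1)).trace) atTop (𝓝 0) := by
  set C : ℝ := ((k + 1 : ℕ) : ℝ) ^ (2 * (k + 1 + 1)) * (d : ℝ) ^ (2 * (k + 1 + 1)) with hC
  have hCpos : 0 ≤ C := by positivity
  have hb := fun n : ℕ => integral_trace_nbMatrix_sq_le (P := P) (hM.measurable (n + 3))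
    (hM.isHermitian (n + 3)) ((hM.ae_hasOrthogonalBlocks hν).mono fun ω h => h (n + 3))
    (hM.integral_block_eq_zero hν) (hM.indep (n + 3)) (k := k + 1) k.succ_pos
  have hs : ∀ n : ℕ, ((Real.sqrt (n + 1)) ^ (k + 1)) ^ 2 = ((n : ℝ) + 1) ^ (k + 1) := fun n => by
    rw [← pow_mul, mul_comm (k + 1) 2, pow_mul, Real.sq_sqrt (by positivity)]
  have h := ae_tendsto_zero_of_summable_integral (P := P)
    (Z := fun n ω => ((((n + 3 : ℕ) : ℝ) * d)⁻¹ * ((Real.sqrt (n + 1)) ^ (k + 1))⁻¹ *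
      (nbMatrix (offDiagPart (M (n + 3) ω)) (k + 1)).trace) ^ 2)
    (c := fun n => ((d : ℝ) ^ 2)⁻¹ * 3 ^ (k + 1) * C * (1 / ((n + 3 : ℕ) : ℝ) ^ 2))
    (fun n ω => sq_nonneg _)
    (fun n => by
      simp only [mul_pow _ (Matrix.trace _)]
      exact (hb n).1.const_mul _)
    (((summable_nat_add_iff 3).2 (Real.summable_one_div_nat_pow.2 one_lt_two)).mul_left _)
    (fun n => by
      simp only [mul_pow _ (Matrix.trace _)]
      rw [integral_const_mul]
      refine (mul_le_mul_of_nonneg_left (hb n).2 (sq_nonneg _)).trans ?_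
      rw [mul_pow, inv_pow, inv_pow, hs, ← hC]
      have h3 : ((n + 3 : ℕ) : ℝ) ^ (k + 1) ≤ 3 ^ (k + 1) * ((n : ℝ) + 1) ^ (k + 1) := by
        rw [← mul_pow]
        refine pow_le_pow_left₀ (by positivity) ?_ _
        push_cast
        have : (0 : ℝ) ≤ n := n.cast_nonneg
        linarith
      have h4 : ((n + 3 : ℕ) : ℝ) ^ (k + 1) * (((n : ℝ) + 1) ^ (k + 1))⁻¹ ≤ 3 ^ (k + 1) := by
        rw [← div_eq_mul_inv, div_le_iff₀ (by positivity)]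
        exact h3
      calc _ = (((n + 3 : ℕ) : ℝ) ^ (k + 1) * (((n : ℝ) + 1) ^ (k + 1))⁻¹) *
            (((d : ℝ) ^ 2)⁻¹ * C * (1 / ((n + 3 : ℕ) : ℝ) ^ 2)) := by
            rw [mul_pow, mul_inv]
            ring
        _ ≤ 3 ^ (k + 1) * (((d : ℝ) ^ 2)⁻¹ * C * (1 / ((n + 3 : ℕ) : ℝ) ^ 2)) :=
            mul_le_mul_of_nonneg_right h4 (by positivity)
        _ = _ := by ring)
  filter_upwards [h] with ω hω
  have := hω.sqrt
  simp only [Real.sqrt_sq_eq_abs, Real.sqrt_zero] at this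
  exact (tendsto_zero_iff_abs_tendsto_zero _).2 this

/-- If the normalized traces of the nonbacktracking matrices tend to `0`, then the moments tend to
those of the semicircle law. With `n + 3` blocks the Chebyshev recursion is normalized by
`√(n + 1)`; the shift by `3` keeps this nonzero. -/
theorem tendsto_trace_aeval_chebyshev {d : ℕ} (hd : 1 ≤ d)
    {A : (n : ℕ) → Matrix (Fin n × Fin d) (Fin n × Fin d) ℝ} (hA : ∀ n, HasInverseBlocks (A n))
    (hnb : ∀ k : ℕ, Tendsto (fun n : ℕ => (((n + 3 : ℕ) : ℝ) * d)⁻¹ *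
      ((Real.sqrt (n + 1)) ^ (k + 1))⁻¹ * (nbMatrix (A (n + 3)) (k + 1)).trace) atTop (𝓝 0))
    (q : ℝ[X]) :
    Tendsto (fun n : ℕ => (((n + 3 : ℕ) : ℝ) * d)⁻¹ *
      (aeval ((Real.sqrt (n + 1))⁻¹ • A (n + 3)) q).trace) atTop
      (𝓝 (∫ x, q.eval x ∂semicircle)) := by
  have hd' : (d : ℝ) ≠ 0 := by positivity
  set L : ℕ → ℝ[X] →ₗ[ℝ] ℝ := fun n => (((n + 3 : ℕ) : ℝ) * d)⁻¹ •
    ((Matrix.traceLinearMap _ ℝ ℝ).comp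
      (aeval ((Real.sqrt (n + 1))⁻¹ • A (n + 3))).toLinearMap) with hL
  have hLq : ∀ n q, L n q = (((n + 3 : ℕ) : ℝ) * d)⁻¹ *
      (aeval ((Real.sqrt (n + 1))⁻¹ • A (n + 3)) q).trace := fun n q => by simp [hL]
  have h1 : ∀ n, L n 1 = 1 := by
    intro n
    rw [hLq, map_one, Matrix.trace_one, Fintype.card_prod, Fintype.card_fin, Fintype.card_fin,
      Nat.cast_mul, inv_mul_cancel₀ (by positivity)]
  have hrec : ∀ n (k : ℕ), L n (S ℝ ((k : ℤ) + 1)) = (((n + 3 : ℕ) : ℝ) * d)⁻¹ *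
      ((Real.sqrt (n + 1)) ^ (k + 1))⁻¹ * (nbMatrix (A (n + 3)) (k + 1)).trace +
      ((n : ℝ) + 1)⁻¹ * L n (S ℝ ((k : ℤ) - 1)) := by
    intro n k
    have hsn : Real.sqrt ((n : ℝ) + 1) ≠ 0 := by positivity
    have hsq : Real.sqrt ((n : ℝ) + 1) ^ 2 = n + 1 := Real.sq_sqrt (by positivity)
    rw [nbMatrix_succ_eq_chebyshev (hA (n + 3)) hsn
      (by rw [hsq, Fintype.card_fin]; push_cast; ring) k, hsq, hLq, hLq]
    simp only [Matrix.trace_smul, Matrix.trace_sub, smul_eq_mul]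
    field_simp
    ring
  have hinv : Tendsto (fun n : ℕ => ((n : ℝ) + 1)⁻¹) atTop (𝓝 0) := by
    simpa using tendsto_one_div_add_atTop_nhds_zero_nat (𝕜 := ℝ)
  -- The correction term of the recursion carries a factor `1 / (n + 1)`, so that only boundedness
  -- of the earlier terms matters.
  have hS : ∀ k : ℕ, Tendsto (fun n => L n (S ℝ ((k : ℤ) + 1))) atTop (𝓝 0) := by
    intro k
    induction k using Nat.twoStepInduction with
    | zero =>
      refine (hnb 0).congr fun n => ?_
      rw [hrec]
      simp
    | one =>
      have h := (hnb 1).add hinv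
      rw [add_zero] at h
      refine h.congr fun n => ?_
      rw [hrec n 1]
      simp [h1]
    | more k ih _ =>
      have h := (hnb (k + 2)).add (hinv.mul ih)
      rw [zero_mul, add_zero] at h
      refine h.congr fun n => ?_
      rw [hrec n (k + 2), show ((k + 2 : ℕ) : ℤ) - 1 = (k : ℤ) + 1 by push_cast; ring]
  simpa only [hLq] using tendsto_polynomial_of_tendsto_S (by simp [h1]) hS q

/-- Almost surely, the moments of the off-diagonal part converge to those of the scaled
semicircle law. -/
theorem IsBlockModel.ae_tendsto_trace_aeval [IsProbabilityMeasure P] (hM : IsBlockModel P ν M)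
    (hν : IsOrthogonalLaw ν) (hd : 1 ≤ d) :
    ∀ᵐ ω ∂P, ∀ q : ℝ[X], Tendsto (fun n : ℕ => ((n : ℝ) * d)⁻¹ *
      (aeval ((1 / Real.sqrt ((n : ℝ) * d)) • offDiagPart (M n ω)) q).trace) atTop
      (𝓝 (∫ x, q.eval x ∂scaledSemicircle (1 / Real.sqrt d))) := by
  filter_upwards [hM.ae_hasOrthogonalBlocks hν,
    ae_all_iff.2 (hM.ae_tendsto_trace_nbMatrix hν)] with ω horth hnb
  have hlim := tendsto_trace_aeval_chebyshev hd
    (fun n => (horth n).hasInverseBlocks (hM.isHermitian n ω)) hnb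
  have hd' : (0 : ℝ) < d := by positivity
  -- Passing from the normalization `√(n + 1)` to `√(N)`, where `N = (n + 3) * d`.
  have hρ : Tendsto (fun n : ℕ => Real.sqrt (n + 1) / Real.sqrt (((n + 3 : ℕ) : ℝ) * d)) atTop
      (𝓝 (1 / Real.sqrt d)) := by
    have h1 : Tendsto (fun n : ℕ => ((n : ℝ) + 1) / (((n + 3 : ℕ) : ℝ) * d)) atTop
        (𝓝 (1 / d)) := by
      have h2 : Tendsto (fun n : ℕ => (1 - 2 * (((n + 3 : ℕ) : ℝ))⁻¹) * (1 / d)) atTop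
          (𝓝 ((1 - 2 * 0) * (1 / d))) :=
        (tendsto_const_nhds.sub (((tendsto_add_atTop_iff_nat 3).2
          (tendsto_inv_atTop_nhds_zero_nat (𝕜 := ℝ))).const_mul 2)).mul_const _
      rw [mul_zero, sub_zero, one_mul] at h2
      refine h2.congr fun n => ?_
      push_cast
      field_simp
      ring
    have h3 := h1.sqrt
    rw [Real.sqrt_div zero_le_one, Real.sqrt_one] at h3
    refine h3.congr fun n => ?_
    rw [Real.sqrt_div (by positivity)]
  intro q
  rw [← tendsto_add_atTop_iff_nat 3]
  induction q using Polynomial.induction_on' with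
  | add p q hp hq =>
    have h := hp.add hq
    simp only [map_add, Matrix.trace_add, mul_add, eval_add]
    rwa [integral_add (integrable_scaledSemicircle _ p.continuous)
      (integrable_scaledSemicircle _ q.continuous)]
  | monomial p a =>
    have h := (hρ.pow p).mul (hlim (monomial p a))
    rw [integral_scaledSemicircle _ (by fun_prop)]
    simp only [eval_monomial, mul_pow, mul_left_comm a (_ ^ p)] at h ⊢
    rw [integral_const_mul]
    refine h.congr fun n => ?_
    have h1 : (1 / Real.sqrt (((n + 3 : ℕ) : ℝ) * d)) • offDiagPart (M (n + 3) ω) =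
        (Real.sqrt (n + 1) / Real.sqrt (((n + 3 : ℕ) : ℝ) * d)) •
          ((Real.sqrt (n + 1))⁻¹ • offDiagPart (M (n + 3) ω)) := by
      rw [smul_smul]
      congr 1
      have : Real.sqrt ((n : ℝ) + 1) ≠ 0 := by positivity
      field_simp
    rw [h1]
    simp only [aeval_monomial, ← Algebra.smul_def, _root_.smul_pow, Matrix.trace_smul, smul_eq_mul]
    ring

end Moments

/-! ### Weak convergence from moments and from monotone functions -/

section MomentMethod

open Polynomial

theorem abs_eval_le_of_one_le_abs (p : ℝ[X]) {x : ℝ} (hx : 1 ≤ |x|) :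
    |p.eval x| ≤ (∑ i ∈ Finset.range (p.natDegree + 1), |p.coeff i|) * |x| ^ (2 * p.natDegree) := by
  rw [eval_eq_sum_range, Finset.sum_mul]
  refine (Finset.abs_sum_le_sum_abs _ _).trans (Finset.sum_le_sum fun i hi => ?_)
  rw [abs_mul, abs_pow]
  refine mul_le_mul_of_nonneg_left (pow_le_pow_right₀ hx ?_) (abs_nonneg _)
  have := Finset.mem_range.1 hi
  omega

/-- The method of moments: convergence of the integrals of polynomials towards those of a compactly
supported law implies convergence of the integrals of bounded continuous functions. The polynomial
approximating `f` on a large interval is controlled outside by high moments. -/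
theorem tendsto_integral_of_tendsto_polynomial {μ : ℕ → Measure ℝ}
    (hμ : ∀ᶠ n in atTop, IsProbabilityMeasure (μ n)) {μ' : Measure ℝ} [IsProbabilityMeasure μ']
    (hint : ∀ n (q : ℝ[X]), Integrable (fun x => q.eval x) (μ n))
    (hsupp : ∀ᵐ x ∂μ', x ∈ Set.Icc (-2 : ℝ) 2)
    (hlim : ∀ q : ℝ[X], Tendsto (fun n => ∫ x, q.eval x ∂μ n) atTop (𝓝 (∫ x, q.eval x ∂μ')))
    (f : BoundedContinuousFunction ℝ ℝ) :
    Tendsto (fun n => ∫ x, f x ∂μ n) atTop (𝓝 (∫ x, f x ∂μ')) := by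
  have hint' : ∀ g : ℝ → ℝ, Continuous g → Integrable g μ' := by
    intro g hg
    obtain ⟨C, hC⟩ := isCompact_Icc.exists_bound_of_continuousOn (s := Set.Icc (-2 : ℝ) 2)
      hg.continuousOn
    refine Integrable.of_bound hg.aestronglyMeasurable C ?_
    filter_upwards [hsupp] with x hx using hC x hx
  rw [Metric.tendsto_atTop]
  intro ε hε
  obtain ⟨p, hp⟩ := exists_polynomial_near_of_continuousOn (-4) 4 f f.continuous.continuousOn
    (ε / 8) (by positivity)
  set r := p.natDegree with hr
  set C : ℝ := ‖f‖ + ∑ i ∈ Finset.range (r + 1), |p.coeff i| with hC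
  have hC0 : 0 ≤ C := by positivity
  -- Off `[-4, 4]` the difference is at most a constant times `x ^ (2 * r)` times a high power of
  -- `x / 4`, whose integral against a law carried by `[-2, 2]` is small.
  have hbound : ∀ (m : ℕ) (x : ℝ),
      |f x - p.eval x| ≤ ε / 8 + C * (4 ^ (2 * m))⁻¹ * x ^ (2 * (r + m)) := by
    intro m x
    by_cases hx : x ∈ Set.Icc (-4 : ℝ) 4
    · have h1 := (hp x hx).le
      have h2 : 0 ≤ C * (4 ^ (2 * m))⁻¹ * x ^ (2 * (r + m)) :=
        mul_nonneg (by positivity) (by rw [pow_mul]; positivity)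
      rw [abs_sub_comm]
      linarith
    · have hx4 : 4 ≤ |x| := by
        rw [Set.mem_Icc, ← abs_le, not_le] at hx
        exact hx.le
      have h1 : |f x| ≤ ‖f‖ * |x| ^ (2 * r) :=
        (f.norm_coe_le_norm x).trans
          (le_mul_of_one_le_right (norm_nonneg _) (one_le_pow₀ (by linarith)))
      have h2 := abs_eval_le_of_one_le_abs p (x := x) (by linarith)
      have h3 : |f x - p.eval x| ≤ C * |x| ^ (2 * r) := by
        rw [hC, add_mul]
        exact (abs_sub _ _).trans (add_le_add h1 h2)
      have h4 : (1 : ℝ) ≤ (4 ^ (2 * m))⁻¹ * |x| ^ (2 * m) := by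
        rw [← div_eq_inv_mul, one_le_div (by positivity)]
        exact pow_le_pow_left₀ (by norm_num) hx4 _
      calc |f x - p.eval x| ≤ C * |x| ^ (2 * r) := h3
        _ ≤ C * |x| ^ (2 * r) * ((4 ^ (2 * m))⁻¹ * |x| ^ (2 * m)) :=
            le_mul_of_one_le_right (by positivity) h4
        _ = C * (4 ^ (2 * m))⁻¹ * x ^ (2 * (r + m)) := by
            rw [← Even.pow_abs (n := 2 * (r + m)) (by simp), mul_add, pow_add]
            ring
        _ ≤ _ := by linarith
  obtain ⟨m, hm⟩ : ∃ m : ℕ, C * 4 ^ r * (1 / 4) ^ m < ε / 8 := by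
    have h := (tendsto_pow_atTop_nhds_zero_of_lt_one (r := (1 / 4 : ℝ)) (by norm_num)
      (by norm_num)).const_mul (C * 4 ^ r)
    rw [mul_zero] at h
    exact (h.eventually_lt_const (by positivity : (0 : ℝ) < ε / 8)).exists
  have hmom : C * (4 ^ (2 * m))⁻¹ * ∫ x, x ^ (2 * (r + m)) ∂μ' < ε / 8 := by
    have h1 : ∫ x, x ^ (2 * (r + m)) ∂μ' ≤ ∫ _, (4 : ℝ) ^ (r + m) ∂μ' := by
      refine integral_mono_ae (hint' _ (by fun_prop)) (integrable_const _) ?_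
      filter_upwards [hsupp] with x hx
      rw [pow_mul]
      refine pow_le_pow_left₀ (sq_nonneg x) ?_ _
      nlinarith [hx.1, hx.2]
    rw [integral_const, probReal_univ, one_smul] at h1
    refine lt_of_le_of_lt (mul_le_mul_of_nonneg_left h1 (by positivity)) (lt_of_le_of_lt ?_ hm)
    rw [pow_add, one_div, inv_pow, pow_mul, show (4 : ℝ) ^ 2 = 4 * 4 by norm_num, mul_pow]
    refine le_of_eq ?_
    field_simp
  have hev1 : ∀ᶠ n in atTop, C * (4 ^ (2 * m))⁻¹ * ∫ x, x ^ (2 * (r + m)) ∂μ n < ε / 8 := by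
    have h := (hlim (X ^ (2 * (r + m)))).const_mul (C * (4 ^ (2 * m))⁻¹)
    simp only [eval_pow, eval_X] at h
    exact h.eventually_lt_const hmom
  have hev2 : ∀ᶠ n in atTop, |∫ x, p.eval x ∂μ n - ∫ x, p.eval x ∂μ'| < ε / 8 := by
    simpa [Real.dist_eq] using Metric.tendsto_nhds.1 (hlim p) (ε / 8) (by positivity)
  refine eventually_atTop.1 ?_
  filter_upwards [hev1, hev2, hμ] with n h1 h2 hprob
  have hfn : Integrable (fun x => f x) (μ n) := f.integrable _
  have hpow : Integrable (fun x : ℝ => x ^ (2 * (r + m))) (μ n) := by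
    simpa using hint n (X ^ (2 * (r + m)))
  have e1 : |∫ x, f x ∂μ n - ∫ x, p.eval x ∂μ n| ≤ ε / 8 + ε / 8 := by
    rw [← integral_sub hfn (hint n p)]
    refine (abs_integral_le_integral_abs).trans ?_
    calc ∫ x, |f x - p.eval x| ∂μ n
        ≤ ∫ x, (ε / 8 + C * (4 ^ (2 * m))⁻¹ * x ^ (2 * (r + m))) ∂μ n :=
          integral_mono (hfn.sub (hint n p)).abs ((integrable_const _).add (hpow.const_mul _))
            (hbound m)
      _ = ε / 8 + C * (4 ^ (2 * m))⁻¹ * ∫ x, x ^ (2 * (r + m)) ∂μ n := by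
          rw [integral_add (integrable_const _) (hpow.const_mul _), integral_const_mul]
          simp
      _ ≤ _ := by linarith
  have e2 : |∫ x, f x ∂μ' - ∫ x, p.eval x ∂μ'| ≤ ε / 8 := by
    rw [← integral_sub (hint' _ f.continuous) (hint' _ p.continuous)]
    refine (abs_integral_le_integral_abs).trans ?_
    calc ∫ x, |f x - p.eval x| ∂μ' ≤ ∫ _, ε / 8 ∂μ' := by
          refine integral_mono_ae (hint' _ (by fun_prop)) (integrable_const _) ?_
          filter_upwards [hsupp] with x hx
          rw [abs_sub_comm]
          exact (hp x ⟨by linarith [hx.1], by linarith [hx.2]⟩).le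
      _ = ε / 8 := by simp
  rw [Real.dist_eq]
  rw [abs_lt] at *
  rw [abs_le] at e1 e2
  constructor <;> linarith [h2.1, h2.2, e1.1, e1.2, e2.1, e2.2]

end MomentMethod

section MonotoneTests

/-- Projection of the real line onto `[-3, 3]`. -/
noncomputable def clampThree (x : ℝ) : ℝ :=
  max (-3) (min 3 x)

theorem monotone_clampThree : Monotone clampThree := fun _ _ h =>
  max_le_max le_rfl (min_le_min le_rfl h)

theorem abs_clampThree_le (x : ℝ) : |clampThree x| ≤ 3 :=
  abs_le.2 ⟨le_max_left _ _, max_le (by norm_num) (min_le_left _ _)⟩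

theorem clampThree_of_abs_le {x : ℝ} (h : |x| ≤ 3) : clampThree x = x := by
  rw [clampThree, min_eq_right (abs_le.1 h).2, max_eq_right (abs_le.1 h).1]

theorem abs_clampThree_sub_le (x y : ℝ) : |clampThree x - clampThree y| ≤ |x - y| := by
  have := abs_max_sub_max_le_abs (min 3 x) (min 3 y) (-3)
  have h2 := abs_min_sub_min_le_max 3 x 3 y
  rw [sub_self, abs_zero, max_eq_right (abs_nonneg _)] at h2
  rw [clampThree, clampThree, max_comm (-3), max_comm (-3)]
  exact this.trans h2

/-- Monotone bounded Lipschitz functions determine weak convergence towards a law carried by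
`[-2, 2]`: a Lipschitz function composed with a projection onto an interval is a difference of two
such functions, and composing with the projection costs nothing in the limit. -/
theorem tendsto_integral_of_monotone {l : Filter ℕ} [l.IsCountablyGenerated] {μ : ℕ → Measure ℝ}
    (hμ : ∀ᶠ n in l, IsProbabilityMeasure (μ n)) {μ' : Measure ℝ} [IsProbabilityMeasure μ']
    (hsupp : ∀ᵐ x ∂μ', x ∈ Set.Icc (-2 : ℝ) 2)
    (hlim : ∀ (g : ℝ → ℝ) (c L : ℝ), Monotone g → 0 ≤ L → (∀ x, |g x| ≤ c) →
      (∀ x y, |g x - g y| ≤ L * |x - y|) →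
      Tendsto (fun n => ∫ x, g x ∂μ n) l (𝓝 (∫ x, g x ∂μ')))
    (f : BoundedContinuousFunction ℝ ℝ) :
    Tendsto (fun n => ∫ x, f x ∂μ n) l (𝓝 (∫ x, f x ∂μ')) := by
  have hbl : ∀ (g : ℝ → ℝ) (c L : ℝ), 0 ≤ L → (∀ x, |g x| ≤ c) →
      (∀ x y, |g x - g y| ≤ L * |x - y|) → Continuous g ∧ ∀ (ρ : Measure ℝ) [IsFiniteMeasure ρ],
        Integrable g ρ := by
    intro g c L hL hc hg
    have hcont : Continuous g := (LipschitzWith.of_dist_le_mul (K := ⟨L, hL⟩) fun x y => by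
      rw [Real.dist_eq, Real.dist_eq]; exact hg x y).continuous
    exact ⟨hcont, fun ρ _ => Integrable.of_bound hcont.aestronglyMeasurable c
      (ae_of_all _ fun x => hc x)⟩
  -- On `[-3, 3]`, `g` is the difference of the monotone functions `g x + L * x` and `L * x`.
  have hclamp : ∀ (g : ℝ → ℝ) (c L : ℝ), 0 ≤ L → (∀ x, |g x| ≤ c) →
      (∀ x y, |g x - g y| ≤ L * |x - y|) →
      Tendsto (fun n => ∫ x, g (clampThree x) ∂μ n) l (𝓝 (∫ x, g x ∂μ')) := by
    intro g c L hL hc hg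
    have b1 : ∀ x, |g (clampThree x) + L * clampThree x| ≤ c + L * 3 := fun x => by
      refine (abs_add_le _ _).trans (add_le_add (hc _) ?_)
      rw [abs_mul, abs_of_nonneg hL]
      exact mul_le_mul_of_nonneg_left (abs_clampThree_le x) hL
    have b2 : ∀ x, |L * clampThree x| ≤ L * 3 := fun x => by
      rw [abs_mul, abs_of_nonneg hL]
      exact mul_le_mul_of_nonneg_left (abs_clampThree_le x) hL
    have l2 : ∀ x y, |L * clampThree x - L * clampThree y| ≤ L * |x - y| := fun x y => by
      rw [← mul_sub, abs_mul, abs_of_nonneg hL]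
      exact mul_le_mul_of_nonneg_left (abs_clampThree_sub_le x y) hL
    have l1 : ∀ x y, |(g (clampThree x) + L * clampThree x) -
        (g (clampThree y) + L * clampThree y)| ≤ (2 * L) * |x - y| := fun x y => by
      rw [add_sub_add_comm]
      refine (abs_add_le _ _).trans ?_
      have := (hg (clampThree x) (clampThree y)).trans
        (mul_le_mul_of_nonneg_left (abs_clampThree_sub_le x y) hL)
      linarith [l2 x y]
    have m1 : Monotone fun x => g (clampThree x) + L * clampThree x := by
      intro x y hxy
      have h1 := (abs_le.1 (hg (clampThree y) (clampThree x))).1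
      rw [abs_of_nonneg (sub_nonneg.2 (monotone_clampThree hxy))] at h1
      simp only
      linarith
    have m2 : Monotone fun x => L * clampThree x := fun x y hxy =>
      mul_le_mul_of_nonneg_left (monotone_clampThree hxy) hL
    obtain ⟨_, i1⟩ := hbl _ _ _ (by positivity) b1 l1
    obtain ⟨_, i2⟩ := hbl _ _ _ hL b2 l2
    have h := (hlim _ _ _ m1 (by positivity) b1 l1).sub (hlim _ _ _ m2 hL b2 l2)
    rw [← integral_sub (i1 _) (i2 _)] at h
    have e : ∫ x, (g (clampThree x) + L * clampThree x - L * clampThree x) ∂μ' =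
        ∫ x, g x ∂μ' := by
      refine integral_congr_ae ?_
      filter_upwards [hsupp] with x hx
      have : |x| ≤ 3 := abs_le.2 ⟨by linarith [hx.1], by linarith [hx.2]⟩
      rw [clampThree_of_abs_le this]
      ring
    rw [e] at h
    refine h.congr' ?_
    filter_upwards [hμ] with n hn
    rw [← integral_sub (i1 _) (i2 _)]
    simp
  -- The tail function `h` vanishes on `[-2, 2]` and equals `1` outside `[-3, 3]`.
  set h : ℝ → ℝ := fun x => min 1 (max 0 (|x| - 2)) with hh
  have h_nonneg : ∀ x, 0 ≤ h x := fun x => le_min zero_le_one (le_max_left _ _)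
  have h_le : ∀ x, |h x| ≤ 1 := fun x => by
    rw [abs_of_nonneg (h_nonneg x)]
    exact min_le_left _ _
  have h_lip : ∀ x y, |h x - h y| ≤ 1 * |x - y| := fun x y => by
    have h1 := abs_min_sub_min_le_max 1 (max 0 (|x| - 2)) 1 (max 0 (|y| - 2))
    have h2 := abs_max_sub_max_le_max 0 (|x| - 2) 0 (|y| - 2)
    rw [sub_self, abs_zero, max_eq_right (abs_nonneg (max 0 (|x| - 2) - max 0 (|y| - 2)))] at h1
    rw [sub_self, abs_zero, max_eq_right (abs_nonneg (|x| - 2 - (|y| - 2))),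
      sub_sub_sub_cancel_right] at h2
    rw [one_mul]
    exact h1.trans (h2.trans (abs_abs_sub_abs_le x y))
  have h_one : ∀ x, 3 ≤ |x| → h x = 1 := fun x hx =>
    min_eq_left (le_max_of_le_right (by linarith))
  have h_clamp : ∀ x, h (clampThree x) = h x := by
    intro x
    rcases le_or_gt |x| 3 with hx | hx
    · rw [clampThree_of_abs_le hx]
    · rw [h_one x hx.le, h_one]
      rw [clampThree]
      rcases lt_abs.1 hx with h3 | h3
      · rw [min_eq_left h3.le, max_eq_right (by norm_num)]
        norm_num
      · rw [min_eq_right (by linarith), max_eq_left (by linarith)]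
        norm_num
  have h_lim : Tendsto (fun n => ∫ x, h x ∂μ n) l (𝓝 0) := by
    have h1 := hclamp h 1 1 zero_le_one h_le h_lip
    simp only [h_clamp] at h1
    have h2 : ∫ x, h x ∂μ' = 0 := by
      refine integral_eq_zero_of_ae ?_
      filter_upwards [hsupp] with x hx
      have : |x| ≤ 2 := abs_le.2 ⟨by linarith [hx.1], by linarith [hx.2]⟩
      simp only [hh, Pi.zero_apply]
      rw [max_eq_left (by linarith), min_eq_right zero_le_one]
    rwa [h2] at h1
  have hlip : ∀ (g : ℝ → ℝ) (c L : ℝ), 0 ≤ L → (∀ x, |g x| ≤ c) →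
      (∀ x y, |g x - g y| ≤ L * |x - y|) →
      Tendsto (fun n => ∫ x, g x ∂μ n) l (𝓝 (∫ x, g x ∂μ')) := by
    intro g c L hL hc hg
    refine (tendsto_iff_of_dist ?_).1 (hclamp g c L hL hc hg)
    have hb : Tendsto (fun n => 2 * c * ∫ x, h x ∂μ n) l (𝓝 0) := by
      simpa using h_lim.const_mul (2 * c)
    refine squeeze_zero' (Eventually.of_forall fun _ => dist_nonneg) ?_ hb
    filter_upwards [hμ] with n hn
    have hgi := (hbl g c L hL hc hg).2 (μ n)
    have hgc : Integrable (fun x => g (clampThree x)) (μ n) :=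
      (hbl (fun x => g (clampThree x)) c L hL (fun x => hc _) fun x y =>
        (hg _ _).trans (mul_le_mul_of_nonneg_left (abs_clampThree_sub_le x y) hL)).2 (μ n)
    have hhi := (hbl h 1 1 zero_le_one h_le h_lip).2 (μ n)
    rw [Real.dist_eq, ← integral_sub hgc hgi, ← integral_const_mul]
    refine (abs_integral_le_integral_abs).trans
      (integral_mono (hgc.sub hgi).abs (hhi.const_mul _) fun x => ?_)
    simp only
    have hc0 : 0 ≤ c := (abs_nonneg _).trans (hc 0)
    rcases le_or_gt |x| 3 with hx | hx
    · rw [clampThree_of_abs_le hx, sub_self, abs_zero]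
      exact mul_nonneg (by linarith) (h_nonneg x)
    · rw [h_one x hx.le]
      refine (abs_sub _ _).trans ?_
      linarith [hc x, hc (clampThree x)]
  obtain ⟨ρ', rfl⟩ : ∃ ρ' : ProbabilityMeasure ℝ, (ρ' : Measure ℝ) = μ' :=
    ⟨⟨μ', inferInstance⟩, rfl⟩
  have hex : ∀ n, ∃ r : ProbabilityMeasure ℝ,
      IsProbabilityMeasure (μ n) → (r : Measure ℝ) = μ n := fun n => by
    by_cases hn : IsProbabilityMeasure (μ n)
    · exact ⟨⟨μ n, hn⟩, fun _ => rfl⟩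
    · exact ⟨ρ', fun h => absurd h hn⟩
  choose ρ hρ using hex
  have hρμ : ∀ᶠ n in l, (ρ n : Measure ℝ) = μ n := hμ.mono fun n hn => hρ n hn
  have hweak : Tendsto ρ l (𝓝 ρ') := by
    rw [tendsto_iff_forall_lipschitz_integral_tendsto]
    rintro g ⟨C, hC⟩ ⟨L, hL⟩
    refine (hlip g (C + |g 0|) L L.2 (fun x => ?_) fun x y => ?_).congr' ?_
    · have := hC x 0
      rw [Real.dist_eq] at this
      have h2 := abs_add_le (g x - g 0) (g 0)
      rw [sub_add_cancel] at h2
      linarith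
    · have := hL.dist_le_mul x y
      rwa [Real.dist_eq, Real.dist_eq] at this
    · filter_upwards [hρμ] with n hn
      rw [hn]
  have := ProbabilityMeasure.tendsto_iff_forall_integral_tendsto.1 hweak f
  refine this.congr' ?_
  filter_upwards [hρμ] with n hn
  rw [hn]

end MonotoneTests

/-! ### Perturbation of spectral distributions -/

section Perturbation

open Matrix

variable {ι : Type*} [Fintype ι]

theorem inner_self_eq_dotProduct (v : EuclideanSpace ℝ ι) :
    inner ℝ v v = v.ofLp ⬝ᵥ v.ofLp := by
  rw [EuclideanSpace.inner_eq_star_dotProduct, star_trivial]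

variable [DecidableEq ι] {A B : Matrix ι ι ℝ}

/-- The coefficient of `v` along the `i`-th eigenvector of `A`. -/
noncomputable def eigenCoeff (hA : A.IsHermitian) (i : ι) : EuclideanSpace ℝ ι →ₗ[ℝ] ℝ :=
  (innerₛₗ ℝ (hA.eigenvectorBasis i))

theorem sum_sq_eigenCoeff (hA : A.IsHermitian) (v : EuclideanSpace ℝ ι) :
    ∑ i, eigenCoeff hA i v ^ 2 = v.ofLp ⬝ᵥ v.ofLp := by
  have h := hA.eigenvectorBasis.sum_inner_mul_inner v v
  rw [← inner_self_eq_dotProduct, ← h]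
  refine Finset.sum_congr rfl fun i _ => ?_
  simp only [eigenCoeff, innerₛₗ_apply_apply, sq]
  rw [real_inner_comm v]

theorem sum_eigenvalues_mul_sq_eigenCoeff (hA : A.IsHermitian) (v : EuclideanSpace ℝ ι) :
    ∑ i, hA.eigenvalues i * eigenCoeff hA i v ^ 2 = v.ofLp ⬝ᵥ A *ᵥ v.ofLp := by
  have h := hA.eigenvectorBasis.sum_inner_mul_inner v (WithLp.toLp 2 (A *ᵥ v.ofLp))
  have h2 : inner ℝ v (WithLp.toLp 2 (A *ᵥ v.ofLp)) = v.ofLp ⬝ᵥ A *ᵥ v.ofLp := by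
    simp [EuclideanSpace.inner_eq_star_dotProduct, dotProduct_comm]
  rw [← h2, ← h]
  refine Finset.sum_congr rfl fun i _ => ?_
  have h3 : inner ℝ (hA.eigenvectorBasis i) (WithLp.toLp 2 (A *ᵥ v.ofLp)) =
      hA.eigenvalues i * inner ℝ (hA.eigenvectorBasis i) v := by
    have hT : Aᵀ = A := hA
    rw [EuclideanSpace.inner_eq_star_dotProduct, EuclideanSpace.inner_eq_star_dotProduct]
    simp only [star_trivial]
    rw [dotProduct_comm, dotProduct_mulVec, ← mulVec_transpose, hT, hA.mulVec_eigenvectorBasis,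
      smul_dotProduct, smul_eq_mul, dotProduct_comm]
  rw [h3, real_inner_comm]
  simp only [eigenCoeff, innerₛₗ_apply_apply, sq]
  ring

/-- If the quadratic form of `A` is at most that of `B` plus `ε` on the vectors vanishing on `bad`,
then some vector witnesses a comparison of eigenvalues as soon as the linear constraints number
less than the dimension. -/
theorem eigenvalue_bound_le (hA : A.IsHermitian) (hB : B.IsHermitian) {bad S T : Finset ι}
    {ε α β : ℝ}
    (hAB : ∀ v : ι → ℝ, (∀ x ∈ bad, v x = 0) → v ⬝ᵥ A *ᵥ v ≤ v ⬝ᵥ B *ᵥ v + ε * (v ⬝ᵥ v))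
    (hS : ∀ i ∉ S, α ≤ hA.eigenvalues i) (hT : ∀ i ∉ T, hB.eigenvalues i ≤ β)
    (hcard : S.card + T.card + bad.card < Fintype.card ι) : α ≤ β + ε := by
  let F : EuclideanSpace ℝ ι →ₗ[ℝ] (S → ℝ) × (T → ℝ) × (bad → ℝ) :=
    (LinearMap.pi fun i : S => eigenCoeff hA i).prod
      ((LinearMap.pi fun i : T => eigenCoeff hB i).prod
        (LinearMap.pi fun i : bad => (EuclideanSpace.proj (i : ι) : EuclideanSpace ℝ ι →L[ℝ] ℝ)))
  have hker : LinearMap.ker F ≠ ⊥ :=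
    LinearMap.ker_ne_bot_of_finrank_lt (by simpa [add_assoc] using hcard)
  obtain ⟨v, hvF, hv0⟩ := Submodule.exists_mem_ne_zero_of_ne_bot hker
  rw [LinearMap.mem_ker] at hvF
  have hvS : ∀ i ∈ S, eigenCoeff hA i v = 0 := fun i hi =>
    congrFun (congrArg Prod.fst hvF) ⟨i, hi⟩
  have hvT : ∀ i ∈ T, eigenCoeff hB i v = 0 := fun i hi =>
    congrFun (congrArg (fun p => p.2.1) hvF) ⟨i, hi⟩
  have hvb : ∀ i ∈ bad, v.ofLp i = 0 := fun i hi =>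
    congrFun (congrArg (fun p => p.2.2) hvF) ⟨i, hi⟩
  have hpos : 0 < v.ofLp ⬝ᵥ v.ofLp := by
    rw [← inner_self_eq_dotProduct]
    exact real_inner_self_pos.2 hv0
  have h1 : α * (v.ofLp ⬝ᵥ v.ofLp) ≤ v.ofLp ⬝ᵥ A *ᵥ v.ofLp := by
    rw [← sum_eigenvalues_mul_sq_eigenCoeff hA, ← sum_sq_eigenCoeff hA, Finset.mul_sum]
    refine Finset.sum_le_sum fun i _ => ?_
    by_cases hi : i ∈ S
    · simp [hvS i hi]
    · exact mul_le_mul_of_nonneg_right (hS i hi) (sq_nonneg _)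
  have h2 : v.ofLp ⬝ᵥ B *ᵥ v.ofLp ≤ β * (v.ofLp ⬝ᵥ v.ofLp) := by
    rw [← sum_eigenvalues_mul_sq_eigenCoeff hB, ← sum_sq_eigenCoeff hB, Finset.mul_sum]
    refine Finset.sum_le_sum fun i _ => ?_
    by_cases hi : i ∈ T
    · simp [hvT i hi]
    · exact mul_le_mul_of_nonneg_right (hT i hi) (sq_nonneg _)
  have h3 := hAB v.ofLp hvb
  refine le_of_mul_le_mul_right ?_ hpos
  linarith

/-- Interlacing: under the hypothesis of `eigenvalue_bound_le`, the eigenvalues in decreasing order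
satisfy `λ_{i+r}(A) ≤ λ_i(B) + ε` where `r` is the number of exceptional coordinates. -/
theorem eigenvalues₀_add_le (hA : A.IsHermitian) (hB : B.IsHermitian) {bad : Finset ι} {ε : ℝ}
    (hAB : ∀ v : ι → ℝ, (∀ x ∈ bad, v x = 0) → v ⬝ᵥ A *ᵥ v ≤ v ⬝ᵥ B *ᵥ v + ε * (v ⬝ᵥ v))
    (i j : Fin (Fintype.card ι)) (hij : (j : ℕ) = bad.card + i) :
    hA.eigenvalues₀ j ≤ hB.eigenvalues₀ i + ε := by
  set e := Fintype.equivOfCardEq (α := Fin (Fintype.card ι)) (β := ι) (Fintype.card_fin _) with he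
  refine eigenvalue_bound_le hA hB (S := (Finset.Ioi j).map e.toEmbedding)
    (T := (Finset.Iio i).map e.toEmbedding) hAB (fun x hx => ?_) (fun x hx => ?_) ?_
  · refine hA.eigenvalues₀_antitone ?_
    by_contra hlt
    exact hx (Finset.mem_map.2 ⟨e.symm x, Finset.mem_Ioi.2 (not_le.1 hlt), e.apply_symm_apply x⟩)
  · refine hB.eigenvalues₀_antitone ?_
    by_contra hlt
    exact hx (Finset.mem_map.2 ⟨e.symm x, Finset.mem_Iio.2 (not_le.1 hlt), e.apply_symm_apply x⟩)
  · rw [Finset.card_map, Finset.card_map, Fin.card_Ioi, Fin.card_Iio]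
    have := j.2
    omega

theorem sum_eigenvalues_eq_sum_eigenvalues₀ (hA : A.IsHermitian) (g : ℝ → ℝ) :
    ∑ i, g (hA.eigenvalues i) = ∑ j, g (hA.eigenvalues₀ j) :=
  (Fintype.equivOfCardEq (α := Fin (Fintype.card ι)) (β := ι) (Fintype.card_fin _)).symm.sum_comp
    fun j => g (hA.eigenvalues₀ j)

/-- Interlacing compares all eigenvalues but `bad.card` of them; each of the others contributes at
most `2 * c`. -/
theorem integral_spectralDistribution_le [Nonempty ι] (hA : A.IsHermitian) (hB : B.IsHermitian)
    {bad : Finset ι} {ε : ℝ} (hε : 0 ≤ ε)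
    (hAB : ∀ v : ι → ℝ, (∀ x ∈ bad, v x = 0) → v ⬝ᵥ A *ᵥ v ≤ v ⬝ᵥ B *ᵥ v + ε * (v ⬝ᵥ v))
    {g : ℝ → ℝ} {c L : ℝ} (hg : Monotone g) (hc : ∀ x, |g x| ≤ c) (hL : 0 ≤ L)
    (hgL : ∀ x y, |g x - g y| ≤ L * |x - y|) :
    ∫ x, g x ∂spectralDistribution hA ≤
      ∫ x, g x ∂spectralDistribution hB + L * ε + 2 * c * (bad.card / Fintype.card ι) := by
  rw [integral_spectralDistribution, integral_spectralDistribution,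
    sum_eigenvalues_eq_sum_eigenvalues₀, sum_eigenvalues_eq_sum_eigenvalues₀]
  have hN : (0 : ℝ) < Fintype.card ι := by exact_mod_cast Fintype.card_pos
  obtain ⟨m, hm⟩ : ∃ m, Fintype.card ι = bad.card + m :=
    ⟨_, (Nat.add_sub_cancel' (Finset.card_le_univ bad)).symm⟩
  set N := Fintype.card ι with hNdef
  have hc0 : 0 ≤ c := (abs_nonneg _).trans (hc 0)
  set a : ℕ → ℝ := fun i => if h : i < N then g (hA.eigenvalues₀ ⟨i, h⟩) else 0 with ha
  set b : ℕ → ℝ := fun i => if h : i < N then g (hB.eigenvalues₀ ⟨i, h⟩) else 0 with hb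
  have hsa : ∑ j, g (hA.eigenvalues₀ j) = ∑ i ∈ Finset.range N, a i := by
    rw [Finset.sum_range]
    exact Finset.sum_congr rfl fun j _ => by simp [ha]
  have hsb : ∑ j, g (hB.eigenvalues₀ j) = ∑ i ∈ Finset.range N, b i := by
    rw [Finset.sum_range]
    exact Finset.sum_congr rfl fun j _ => by simp [hb]
  have hac : ∀ i, a i ≤ c := fun i => by
    simp only [ha]
    split_ifs
    exacts [(le_abs_self _).trans (hc _), hc0]
  have hbc : ∀ i, -c ≤ b i := fun i => by
    simp only [hb]
    split_ifs
    exacts [(abs_le.1 (hc _)).1, by linarith]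
  have hshift : ∀ i ∈ Finset.range m, a (bad.card + i) ≤ b i + L * ε := by
    intro i hi
    rw [Finset.mem_range] at hi
    have h1 : bad.card + i < N := by omega
    have h2 : i < N := by omega
    simp only [ha, hb, h1, h2, dif_pos]
    have h3 := eigenvalues₀_add_le hA hB hAB ⟨i, h2⟩ ⟨bad.card + i, h1⟩ rfl
    have h4 := (le_abs_self _).trans (hgL (hB.eigenvalues₀ ⟨i, h2⟩ + ε) (hB.eigenvalues₀ ⟨i, h2⟩))
    rw [add_sub_cancel_left, abs_of_nonneg hε] at h4
    linarith [hg h3]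
  have htail : ∑ i ∈ Finset.range m, b i ≤ ∑ i ∈ Finset.range N, b i + bad.card * c := by
    rw [hm, add_comm bad.card m, Finset.sum_range_add]
    have : ∑ _i ∈ Finset.range bad.card, (-c) ≤ ∑ i ∈ Finset.range bad.card, b (m + i) :=
      Finset.sum_le_sum fun i _ => hbc _
    rw [Finset.sum_const, Finset.card_range, nsmul_eq_mul] at this
    linarith
  have hmain : ∑ i ∈ Finset.range N, a i ≤
      ∑ i ∈ Finset.range N, b i + N * (L * ε) + 2 * c * bad.card := by
    calc ∑ i ∈ Finset.range N, a i
        = ∑ i ∈ Finset.range bad.card, a i + ∑ i ∈ Finset.range m, a (bad.card + i) := by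
          rw [hm, Finset.sum_range_add]
      _ ≤ ∑ _i ∈ Finset.range bad.card, c + ∑ i ∈ Finset.range m, (b i + L * ε) :=
          add_le_add (Finset.sum_le_sum fun i _ => hac i) (Finset.sum_le_sum hshift)
      _ = bad.card * c + (∑ i ∈ Finset.range m, b i + m * (L * ε)) := by
          rw [Finset.sum_add_distrib]
          simp
      _ ≤ _ := by
          have hmN : (m : ℝ) ≤ N := by exact_mod_cast (by omega : m ≤ N)
          have := mul_le_mul_of_nonneg_right hmN (mul_nonneg hL hε)
          linarith
  rw [hsa, hsb]
  refine (mul_le_mul_of_nonneg_left hmain (inv_nonneg.2 hN.le)).trans (le_of_eq ?_)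
  rw [← hNdef]
  field_simp

/-- Two symmetric matrices whose quadratic forms differ by at most `ε` off few coordinates have
close spectral distributions, as tested by monotone bounded Lipschitz functions. -/
theorem abs_integral_spectralDistribution_sub_le [Nonempty ι] (hA : A.IsHermitian)
    (hB : B.IsHermitian) {bad : Finset ι} {ε : ℝ} (hε : 0 ≤ ε)
    (hAB : ∀ v : ι → ℝ, (∀ x ∈ bad, v x = 0) →
      |v ⬝ᵥ A *ᵥ v - v ⬝ᵥ B *ᵥ v| ≤ ε * (v ⬝ᵥ v))
    {g : ℝ → ℝ} {c L : ℝ} (hg : Monotone g) (hc : ∀ x, |g x| ≤ c) (hL : 0 ≤ L)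
    (hgL : ∀ x y, |g x - g y| ≤ L * |x - y|) :
    |∫ x, g x ∂spectralDistribution hA - ∫ x, g x ∂spectralDistribution hB| ≤
      L * ε + 2 * c * (bad.card / Fintype.card ι) := by
  have h1 := integral_spectralDistribution_le hA hB hε
    (fun v hv => by linarith [(abs_le.1 (hAB v hv)).2]) hg hc hL hgL
  have h2 := integral_spectralDistribution_le hB hA hε
    (fun v hv => by linarith [(abs_le.1 (hAB v hv)).1]) hg hc hL hgL
  rw [abs_le]
  constructor <;> linarith

end Perturbation

section BlockDiagonal

variable {n d : ℕ}

/-- The sum of the absolute values of the entries of the `i`-th diagonal block. -/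
def diagBlockSize (A : Matrix (Fin n × Fin d) (Fin n × Fin d) ℝ) (i : Fin n) : ℝ :=
  ∑ a, ∑ b, |A (i, a) (i, b)|

open Matrix in
/-- The quadratic form of the block diagonal part is at most `δ` on the vectors vanishing on the
blocks of size greater than `δ`. -/
theorem abs_dotProduct_blockDiagPart_le (A : Matrix (Fin n × Fin d) (Fin n × Fin d) ℝ) {δ : ℝ}
    (v : Fin n × Fin d → ℝ) (hv : ∀ i a, δ < diagBlockSize A i → v (i, a) = 0) :
    |v ⬝ᵥ blockDiagPart A *ᵥ v| ≤ δ * (v ⬝ᵥ v) := by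
  have h1 : v ⬝ᵥ blockDiagPart A *ᵥ v =
      ∑ i, ∑ a, ∑ b, A (i, a) (i, b) * (v (i, a) * v (i, b)) := by
    simp only [dotProduct, mulVec, Fintype.sum_prod_type, Finset.mul_sum, blockDiagPart,
      Matrix.of_apply]
    refine Finset.sum_congr rfl fun i _ => Finset.sum_congr rfl fun a _ => ?_
    rw [Finset.sum_eq_single i]
    · refine Finset.sum_congr rfl fun b _ => ?_
      simp
      ring
    · intro j _ hj
      simp [Ne.symm hj]
    · simp
  have h2 : v ⬝ᵥ v = ∑ i, ∑ c, v (i, c) * v (i, c) := by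
    simp [dotProduct, Fintype.sum_prod_type]
  rw [h1, h2, Finset.mul_sum]
  refine (Finset.abs_sum_le_sum_abs _ _).trans (Finset.sum_le_sum fun i _ => ?_)
  have hsq : ∀ a, v (i, a) * v (i, a) ≤ ∑ c, v (i, c) * v (i, c) := fun a =>
    Finset.single_le_sum (f := fun c => v (i, c) * v (i, c)) (fun c _ => mul_self_nonneg _)
      (Finset.mem_univ a)
  have h3 : |∑ a, ∑ b, A (i, a) (i, b) * (v (i, a) * v (i, b))| ≤
      diagBlockSize A i * ∑ c, v (i, c) * v (i, c) := by
    rw [diagBlockSize, Finset.sum_mul]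
    refine (Finset.abs_sum_le_sum_abs _ _).trans (Finset.sum_le_sum fun a _ => ?_)
    rw [Finset.sum_mul]
    refine (Finset.abs_sum_le_sum_abs _ _).trans (Finset.sum_le_sum fun b _ => ?_)
    rw [abs_mul]
    refine mul_le_mul_of_nonneg_left ?_ (abs_nonneg _)
    rw [abs_le]
    constructor <;> nlinarith [hsq a, hsq b, sq_nonneg (v (i, a) - v (i, b)),
      sq_nonneg (v (i, a) + v (i, b))]
  rcases le_or_gt (diagBlockSize A i) δ with h | h
  · exact h3.trans (mul_le_mul_of_nonneg_right h
      (Finset.sum_nonneg fun c _ => mul_self_nonneg _))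
  · simp [hv i _ h]

theorem opNorm_nonneg {ι : Type*} [Fintype ι] [DecidableEq ι] (A : Matrix ι ι ℝ) :
    0 ≤ opNorm A :=
  norm_nonneg _

theorem abs_apply_le_opNorm {ι : Type*} [Fintype ι] [DecidableEq ι] (A : Matrix ι ι ℝ) (x y : ι) :
    |A x y| ≤ opNorm A := by
  have h1 : A x y = inner ℝ (EuclideanSpace.single x (1 : ℝ))
      (Matrix.toEuclideanCLM (𝕜 := ℝ) A (EuclideanSpace.single y 1)) := by
    rw [EuclideanSpace.inner_single_left]
    simp [Matrix.ofLp_toEuclideanCLM]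
  rw [h1]
  refine (abs_real_inner_le_norm _ _).trans ?_
  have h2 := (Matrix.toEuclideanCLM (𝕜 := ℝ) A).le_opNorm (EuclideanSpace.single y 1)
  simpa [opNorm] using h2

theorem diagBlockSize_le_opNorm (A : Matrix (Fin n × Fin d) (Fin n × Fin d) ℝ) (i : Fin n) :
    diagBlockSize A i ≤ d ^ 2 * opNorm (blockDiagPart A) := by
  have h : ∀ a b : Fin d, |A (i, a) (i, b)| ≤ opNorm (blockDiagPart A) := fun a b => by
    simpa [blockDiagPart] using abs_apply_le_opNorm (blockDiagPart A) (i, a) (i, b)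
  refine (Finset.sum_le_sum fun a _ => Finset.sum_le_sum fun b _ => h a b).trans (le_of_eq ?_)
  simp
  ring

end BlockDiagonal

/-! ### Convergence in probability -/

section Pathwise

theorem integrable_spectralDistribution {ι : Type*} [Fintype ι] [DecidableEq ι]
    {A : Matrix ι ι ℝ} (hA : A.IsHermitian) (f : ℝ → ℝ) :
    Integrable f (spectralDistribution hA) := by
  rcases isEmpty_or_nonempty ι with h | h
  · simp [spectralDistribution]
  · refine Integrable.smul_measure ?_ (by simp)
    rw [integrable_finsetSum_measure]
    exact fun i _ => integrable_dirac (by simp)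

theorem ae_scaledSemicircle_mem_Icc {d : ℕ} (hd : 1 ≤ d) :
    ∀ᵐ x ∂scaledSemicircle (1 / Real.sqrt d), x ∈ Set.Icc (-2 : ℝ) 2 := by
  refine (ae_map_iff (by fun_prop) measurableSet_Icc).2 ?_
  filter_upwards [ae_semicircle_mem_Icc] with x hx
  have h1 : |1 / Real.sqrt d| ≤ 1 := by
    rw [abs_of_nonneg (by positivity), div_le_one (by positivity), Real.one_le_sqrt]
    exact_mod_cast hd
  have h2 : |x| ≤ 2 := abs_le.2 hx
  rw [← abs_le, abs_mul]
  nlinarith [abs_nonneg x, abs_nonneg (1 / Real.sqrt d)]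

variable {d : ℕ}

/-- The indices of the diagonal blocks of size greater than `δ`. -/
noncomputable def badBlocks {n : ℕ} (A : Matrix (Fin n × Fin d) (Fin n × Fin d) ℝ) (δ : ℝ) :
    Finset (Fin n) :=
  {i | δ < diagBlockSize A i}

/-- If the moments of the off-diagonal part converge to those of the scaled semicircle law and
the proportion of large diagonal blocks vanishes, then the spectral distributions converge. -/
theorem tendsto_integral_spectralDistribution (hd : 1 ≤ d)
    {A : (n : ℕ) → Matrix (Fin n × Fin d) (Fin n × Fin d) ℝ} (hA : ∀ n, (A n).IsHermitian)
    (hmom : ∀ q : Polynomial ℝ, Tendsto (fun n : ℕ => ((n : ℝ) * d)⁻¹ *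
      (Polynomial.aeval ((1 / Real.sqrt ((n : ℝ) * d)) • offDiagPart (A n)) q).trace) atTop
      (𝓝 (∫ x, q.eval x ∂scaledSemicircle (1 / Real.sqrt d))))
    {l : Filter ℕ} [l.IsCountablyGenerated] (hl : l ≤ atTop)
    (hbad : ∀ ε > 0, Tendsto (fun n : ℕ =>
      ((badBlocks (A n) (ε * Real.sqrt ((n : ℝ) * d))).card : ℝ) / n) l (𝓝 0))
    (f : BoundedContinuousFunction ℝ ℝ) :
    Tendsto (fun n : ℕ => ∫ x, f x ∂spectralDistribution
      (isHermitian_smul (hA n) (1 / Real.sqrt ((n : ℝ) * d)))) l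
      (𝓝 (∫ x, f x ∂scaledSemicircle (1 / Real.sqrt d))) := by
  have hne : ∀ n : ℕ, 1 ≤ n → Nonempty (Fin n × Fin d) := fun n hn =>
    ⟨(⟨0, hn⟩, ⟨0, hd⟩)⟩
  have hoff := fun n => isHermitian_smul (isHermitian_offDiagPart (hA n))
    (1 / Real.sqrt ((n : ℝ) * d))
  have hev : ∀ᶠ n : ℕ in atTop, 1 ≤ n := eventually_ge_atTop 1
  have hlim : ∀ g : BoundedContinuousFunction ℝ ℝ,
      Tendsto (fun n => ∫ x, g x ∂spectralDistribution (hoff n)) atTop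
        (𝓝 (∫ x, g x ∂scaledSemicircle (1 / Real.sqrt d))) := by
    refine tendsto_integral_of_tendsto_polynomial ?_ ?_ (ae_scaledSemicircle_mem_Icc hd) ?_
    · filter_upwards [hev] with n hn
      have := hne n hn
      exact isProbabilityMeasure_spectralDistribution _
    · exact fun n q => integrable_spectralDistribution _ _
    · intro q
      refine (hmom q).congr fun n => ?_
      rw [integral_spectralDistribution, sum_eval_eigenvalues]
      simp
  refine tendsto_integral_of_monotone ?_ (ae_scaledSemicircle_mem_Icc hd) ?_ f
  · filter_upwards [hl hev] with n hn
    have := hne n hn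
    exact isProbabilityMeasure_spectralDistribution _
  intro g c L hg hL hc hgL
  have hcont : Continuous g := (LipschitzWith.of_dist_le_mul (K := ⟨L, hL⟩) fun x y => by
    rw [Real.dist_eq, Real.dist_eq]; exact hgL x y).continuous
  have h1 := (hlim (BoundedContinuousFunction.ofNormedAddCommGroup g hcont c hc)).mono_left hl
  simp only [BoundedContinuousFunction.coe_ofNormedAddCommGroup] at h1
  refine (tendsto_iff_of_dist ?_).1 h1
  rw [Metric.tendsto_nhds]
  intro η hη
  have hε : 0 < η / (2 * (L + 1)) := by positivity
  have h2 := ((hbad _ hε).const_mul (2 * c)).eventually_lt_const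
    (show 2 * c * 0 < η / 2 by rw [mul_zero]; positivity)
  filter_upwards [hl hev, h2] with n hn h2
  have := hne n hn
  have hN : (0 : ℝ) < (n : ℝ) * d := by positivity
  rw [Real.dist_0_eq_abs, abs_of_nonneg dist_nonneg, dist_comm, Real.dist_eq]
  refine lt_of_le_of_lt (abs_integral_spectralDistribution_sub_le
    (isHermitian_smul (hA n) _) (hoff n)
    (bad := badBlocks (A n) (η / (2 * (L + 1)) * Real.sqrt ((n : ℝ) * d)) ×ˢ Finset.univ)
    hε.le ?_ hg hc hL hgL) ?_
  · intro v hv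
    have h3 := abs_dotProduct_blockDiagPart_le (A n) v
      (δ := η / (2 * (L + 1)) * Real.sqrt ((n : ℝ) * d)) fun i a hi =>
        hv (i, a) (Finset.mem_product.2 ⟨Finset.mem_filter.2 ⟨Finset.mem_univ _, hi⟩,
          Finset.mem_univ _⟩)
    have h4 : dotProduct v (((1 / Real.sqrt ((n : ℝ) * d)) • A n).mulVec v) -
        dotProduct v (((1 / Real.sqrt ((n : ℝ) * d)) • offDiagPart (A n)).mulVec v) =
        (1 / Real.sqrt ((n : ℝ) * d)) * dotProduct v ((blockDiagPart (A n)).mulVec v) := by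
      conv_lhs => enter [1]; rw [← offDiagPart_add_blockDiagPart (A n)]
      rw [smul_add, Matrix.add_mulVec, dotProduct_add, Matrix.smul_mulVec, Matrix.smul_mulVec,
        dotProduct_smul, dotProduct_smul, smul_eq_mul, smul_eq_mul, add_sub_cancel_left]
    rw [h4, abs_mul, abs_of_nonneg (by positivity)]
    refine (mul_le_mul_of_nonneg_left h3 (by positivity)).trans (le_of_eq ?_)
    field_simp
  · have hLη : L * (η / (2 * (L + 1))) ≤ η / 2 := by
      rw [← mul_div_assoc, div_le_div_iff₀ (by positivity) (by positivity)]
      nlinarith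
    have hcard : (((badBlocks (A n) (η / (2 * (L + 1)) * Real.sqrt ((n : ℝ) * d)) ×ˢ
        (Finset.univ : Finset (Fin d))).card : ℝ) / (Fintype.card (Fin n × Fin d) : ℝ)) =
        ((badBlocks (A n) (η / (2 * (L + 1)) * Real.sqrt ((n : ℝ) * d))).card : ℝ) / n := by
      rw [Finset.card_product, Fintype.card_prod]
      simp only [Finset.card_univ, Fintype.card_fin, Nat.cast_mul]
      have hd' : (d : ℝ) ≠ 0 := by positivity
      field_simp
    rw [hcard]
    linarith

end Pathwise

section Measurability

/-- Approximating `f` by polynomials reduces the claim to the measurability of traces and avoids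
that of the eigenvalues. -/
theorem measurable_integral_spectralDistribution {Ω ι : Type*} [MeasurableSpace Ω] [Fintype ι]
    [DecidableEq ι] {A : Ω → Matrix ι ι ℝ} (hmeas : Measurable A) (hA : ∀ ω, (A ω).IsHermitian)
    (f : BoundedContinuousFunction ℝ ℝ) :
    Measurable fun ω => ∫ x, f x ∂spectralDistribution (hA ω) := by
  choose p hp using fun j : ℕ => exists_polynomial_near_of_continuousOn (-(j : ℝ)) j f
    f.continuous.continuousOn (1 / ((j : ℝ) + 1)) (by positivity)
  have hlim : ∀ x, Tendsto (fun j => (p j).eval x) atTop (𝓝 (f x)) := by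
    intro x
    rw [tendsto_iff_dist_tendsto_zero]
    refine squeeze_zero' (Eventually.of_forall fun _ => dist_nonneg) ?_
      (tendsto_one_div_add_atTop_nhds_zero_nat (𝕜 := ℝ))
    obtain ⟨m, hm⟩ := exists_nat_ge |x|
    filter_upwards [eventually_ge_atTop m] with j hj
    rw [Real.dist_eq]
    refine (hp j x (abs_le.1 (hm.trans ?_))).le
    exact_mod_cast hj
  refine measurable_of_tendsto_metrizable
    (f := fun j ω => (Fintype.card ι : ℝ)⁻¹ * (Polynomial.aeval (A ω) (p j)).trace) (fun j => ?_) ?_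
  · have : Continuous fun B : Matrix ι ι ℝ => (Polynomial.aeval B (p j)).trace :=
      (Polynomial.continuous_aeval (p j)).matrix_trace
    exact (this.measurable.comp hmeas).const_mul _
  · rw [tendsto_pi_nhds]
    intro ω
    simp only [integral_spectralDistribution, ← sum_eval_eigenvalues (hA ω)]
    exact (tendsto_finsetSum _ fun i _ => hlim _).const_mul _

theorem measurable_diagBlockSize {n d : ℕ} (i : Fin n) :
    Measurable fun A : Matrix (Fin n × Fin d) (Fin n × Fin d) ℝ => diagBlockSize A i := by
  unfold diagBlockSize
  fun_prop

end Measurability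

section InProbability

variable {Ω : Type*} [MeasurableSpace Ω] {P : Measure Ω} [IsProbabilityMeasure P] {d : ℕ}
  {ν : Measure (Matrix (Fin d) (Fin d) ℝ)}
  {M : (n : ℕ) → Ω → Matrix (Fin n × Fin d) (Fin n × Fin d) ℝ}

/-- Every subsequence has a further subsequence along which the diagonal part is almost surely
negligible, so that the deterministic convergence theorem applies. -/
theorem IsBlockModel.tendstoInMeasure_integral (hM : IsBlockModel P ν M) (hν : IsOrthogonalLaw ν)
    (hd : 1 ≤ d)
    (hdiag : TendstoInMeasure P (fun n ω => opNorm (blockDiagPart (M n ω)) /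
      Real.sqrt ((n : ℝ) * d)) atTop (fun _ => (0 : ℝ)))
    (f : BoundedContinuousFunction ℝ ℝ) :
    TendstoInMeasure P (fun n ω => ∫ x, f x ∂spectralDistribution
      (isHermitian_smul (hM.isHermitian n ω) (1 / Real.sqrt ((n : ℝ) * d)))) atTop
      (fun _ => ∫ x, f x ∂scaledSemicircle (1 / Real.sqrt d)) := by
  rw [exists_seq_tendstoInMeasure_atTop_iff fun n =>
    (measurable_integral_spectralDistribution (by
      have := hM.measurable n
      exact this.const_smul (1 / Real.sqrt ((n : ℝ) * d))) _ f).aestronglyMeasurable]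
  intro ns hns
  obtain ⟨ns', hns', hae⟩ := (hdiag.comp hns.tendsto_atTop).exists_seq_tendsto_ae
  refine ⟨ns', hns', ?_⟩
  filter_upwards [hae, hM.ae_tendsto_trace_aeval hν hd] with ω hω hmom
  have hlim : Tendsto (fun i => ns (ns' i)) atTop atTop :=
    hns.tendsto_atTop.comp hns'.tendsto_atTop
  refine (tendsto_integral_spectralDistribution hd (fun n => hM.isHermitian n ω) hmom
    (l := Filter.map (fun i => ns (ns' i)) atTop) hlim ?_ f)
  intro ε hε
  rw [tendsto_map'_iff]
  have hd' : (0 : ℝ) < d := by positivity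
  have hsmall := (Metric.tendsto_nhds.1 hω) (ε / d ^ 2) (by positivity)
  refine tendsto_const_nhds.congr' ?_
  filter_upwards [hsmall, hlim.eventually (eventually_ge_atTop 1)] with i hi hi1
  simp only [Function.comp_def] at hi ⊢
  have hN : (0 : ℝ) < ((ns (ns' i) : ℕ) : ℝ) * d := by positivity
  -- When the operator norm of the diagonal part is small, no diagonal block is large.
  have hempty : badBlocks (M (ns (ns' i)) ω)
      (ε * Real.sqrt (((ns (ns' i) : ℕ) : ℝ) * d)) = ∅ := by
    refine Finset.filter_eq_empty_iff.2 fun j _ => not_lt.2 ?_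
    refine (diagBlockSize_le_opNorm _ j).trans ?_
    rw [Real.dist_0_eq_abs, abs_of_nonneg (div_nonneg (opNorm_nonneg _) (Real.sqrt_nonneg _)),
      div_lt_div_iff₀ (by positivity) (by positivity)] at hi
    linarith
  rw [hempty]
  simp

end InProbability

/-! ### Bordered models -/

section Bordered

variable {Ω : Type*} [MeasurableSpace Ω] {P : Measure Ω} {d : ℕ}
  {ν : Measure (Matrix (Fin d) (Fin d) ℝ)}
  {M : (n : ℕ) → Ω → Matrix (Fin n × Fin d) (Fin n × Fin d) ℝ}

/-- The size of the diagonal block adjoined when passing from `M i` to `M (i + 1)`. -/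
def newBlockSize (M : (n : ℕ) → Ω → Matrix (Fin n × Fin d) (Fin n × Fin d) ℝ) (i : ℕ) (ω : Ω) : ℝ :=
  diagBlockSize (M (i + 1) ω) (Fin.last i)

theorem IsBordered.diagBlockSize_eq (hB : IsBordered P M) (n : ℕ) (ω : Ω) (i : Fin n) :
    diagBlockSize (M n ω) i = newBlockSize M i ω := by
  induction n with
  | zero => exact i.elim0
  | succ n ih =>
    rcases Fin.eq_castSucc_or_eq_last i with ⟨j, rfl⟩ | rfl
    · rw [Fin.val_castSucc, ← ih j]
      have h : ∀ a b, M (n + 1) ω (j.castSucc, a) (j.castSucc, b) = M n ω (j, a) (j, b) :=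
        fun a b => congrFun (congrFun (hB.nested n ω j j) a) b
      simp only [diagBlockSize, h]
    · rfl

theorem measurable_newBlockSize (hM : ∀ n, Measurable (M n)) (i : ℕ) :
    Measurable (newBlockSize M i) :=
  (measurable_diagBlockSize (Fin.last i)).comp (hM (i + 1))

variable [IsProbabilityMeasure P]

/-- The diagonal blocks of a bordered model are independent. -/
theorem IsBordered.measureReal_forall_le (hB : IsBordered P M) (c : ℝ) (n : ℕ) :
    P.real {ω | ∀ i < n, newBlockSize M i ω ≤ c} =
      ∏ i ∈ Finset.range n, P.real {ω | newBlockSize M i ω ≤ c} := by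
  induction n with
  | zero => simp
  | succ n ih =>
    rw [Finset.prod_range_succ, ← ih]
    have h1 : {ω | ∀ i < n, newBlockSize M i ω ≤ c} =
        M n ⁻¹' {A | ∀ i : Fin n, diagBlockSize A i ≤ c} := by
      ext ω
      simp only [Set.mem_ofPred_eq, Set.mem_preimage, hB.diagBlockSize_eq]
      exact ⟨fun h i => h i i.2, fun h i hi => h ⟨i, hi⟩⟩
    have h2 : {ω | newBlockSize M n ω ≤ c} =
        (fun ω (i : Fin (n + 1)) => block (M (n + 1) ω) i (Fin.last n)) ⁻¹'
          {C | ∑ a, ∑ b, |C (Fin.last n) a b| ≤ c} := rfl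
    have h3 : {ω | ∀ i < n + 1, newBlockSize M i ω ≤ c} =
        {ω | ∀ i < n, newBlockSize M i ω ≤ c} ∩ {ω | newBlockSize M n ω ≤ c} := by
      ext ω
      simp only [Set.mem_ofPred_eq, Set.mem_inter_iff]
      exact Nat.forall_lt_succ_right
    rw [h3, h1, h2]
    simp only [Measure.real]
    rw [(hB.indep n).measure_inter_preimage_eq_mul _ _ ?_ ?_, ENNReal.toReal_mul]
    · rw [Set.ofPred_forall]
      exact MeasurableSet.iInter fun i =>
        measurableSet_le (measurable_diagBlockSize i) measurable_const
    · exact measurableSet_le (by fun_prop) measurable_const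

/-- If the diagonal part is negligible in probability, independence bounds the expected number of
large diagonal blocks: if it is unlikely that any of independent events occurs, then their
probabilities have a bounded sum. -/
theorem IsBordered.eventually_sum_measureReal_le (hB : IsBordered P M) (hM : ∀ n, Measurable (M n))
    (hd : 1 ≤ d)
    (hdiag : TendstoInMeasure P (fun n ω => opNorm (blockDiagPart (M n ω)) /
      Real.sqrt ((n : ℝ) * d)) atTop (fun _ => (0 : ℝ))) {ε : ℝ} (hε : 0 < ε) :
    ∀ᶠ n : ℕ in atTop, ∑ i ∈ Finset.range n,
      P.real {ω | ε * Real.sqrt ((n : ℝ) * d) < newBlockSize M i ω} ≤ 1 := by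
  have hd' : (0 : ℝ) < d := by positivity
  have hsmall := (hdiag (ENNReal.ofReal (ε / d ^ 2)) (by positivity)).eventually_lt_const
    (show (0 : ENNReal) < ENNReal.ofReal (1 / 2) by positivity)
  filter_upwards [hsmall, eventually_ge_atTop 1] with n hn hn1
  have hN : (0 : ℝ) < (n : ℝ) * d := by positivity
  set c := ε * Real.sqrt ((n : ℝ) * d) with hc
  have hsub : {ω | ∀ i < n, newBlockSize M i ω ≤ c}ᶜ ⊆
      {ω | ENNReal.ofReal (ε / d ^ 2) ≤
        edist (opNorm (blockDiagPart (M n ω)) / Real.sqrt ((n : ℝ) * d)) 0} := by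
    intro ω hω
    rw [Set.mem_compl_iff, Set.mem_ofPred_eq] at hω
    push Not at hω
    obtain ⟨i, hi, hci⟩ := hω
    have h1 := diagBlockSize_le_opNorm (M n ω) ⟨i, hi⟩
    rw [hB.diagBlockSize_eq] at h1
    have h2 := hci.trans_le h1
    rw [Set.mem_ofPred_eq, edist_dist, Real.dist_0_eq_abs,
      abs_of_nonneg (div_nonneg (opNorm_nonneg _) (Real.sqrt_nonneg _))]
    refine ENNReal.ofReal_le_ofReal ?_
    rw [div_le_div_iff₀ (by positivity) (by positivity)]
    linarith
  have hmeas : MeasurableSet {ω | ∀ i < n, newBlockSize M i ω ≤ c} := by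
    simp only [Set.ofPred_forall]
    exact MeasurableSet.iInter fun i => MeasurableSet.iInter fun _ =>
      measurableSet_le (measurable_newBlockSize hM i) measurable_const
  have hhalf : 1 / 2 ≤ P.real {ω | ∀ i < n, newBlockSize M i ω ≤ c} := by
    have h1 : P.real {ω | ∀ i < n, newBlockSize M i ω ≤ c}ᶜ ≤ 1 / 2 := by
      refine ENNReal.toReal_le_of_le_ofReal (by norm_num) ?_
      exact (measure_mono hsub).trans hn.le
    rw [probReal_compl_eq_one_sub hmeas] at h1
    linarith
  rw [hB.measureReal_forall_le] at hhalf
  set p : ℕ → ℝ := fun i => P.real {ω | c < newBlockSize M i ω} with hp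
  have hp1 : ∀ i, P.real {ω | newBlockSize M i ω ≤ c} = 1 - p i := by
    intro i
    have h1 : {ω | newBlockSize M i ω ≤ c} = {ω | c < newBlockSize M i ω}ᶜ := by
      ext ω
      simp
    rw [h1, probReal_compl_eq_one_sub
      (measurableSet_lt measurable_const (measurable_newBlockSize hM i))]
  have hexp : ∏ i ∈ Finset.range n, P.real {ω | newBlockSize M i ω ≤ c} ≤
      Real.exp (-∑ i ∈ Finset.range n, p i) := by
    rw [← Finset.sum_neg_distrib, Real.exp_sum]
    refine Finset.prod_le_prod (fun i _ => measureReal_nonneg) fun i _ => ?_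
    rw [hp1]
    exact Real.one_sub_le_exp_neg _
  have h3 : 1 / 2 * Real.exp (∑ i ∈ Finset.range n, p i) ≤ 1 := by
    refine (mul_le_mul_of_nonneg_right (hhalf.trans hexp) (Real.exp_pos _).le).trans ?_
    rw [← Real.exp_add, neg_add_cancel, Real.exp_zero]
  have h4 := Real.add_one_le_exp (∑ i ∈ Finset.range n, p i)
  linarith

/-- Almost surely, the proportion of large diagonal blocks of a bordered model vanishes. The bound
on their expected number is used along powers of `2`, where it is summable. -/
theorem IsBordered.ae_tendsto_card_badBlocks (hB : IsBordered P M) (hM : ∀ n, Measurable (M n))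
    (hd : 1 ≤ d)
    (hdiag : TendstoInMeasure P (fun n ω => opNorm (blockDiagPart (M n ω)) /
      Real.sqrt ((n : ℝ) * d)) atTop (fun _ => (0 : ℝ))) {ε : ℝ} (hε : 0 < ε) :
    ∀ᵐ ω ∂P, Tendsto (fun n : ℕ =>
      ((badBlocks (M n ω) (ε * Real.sqrt ((n : ℝ) * d))).card : ℝ) / n) atTop (𝓝 0) := by
  -- For `2 ^ j ≤ n < 2 ^ (j + 1)`, the bad blocks of `M n` are among the blocks counted by `Z j`:
  -- the factor `1 / 2` in the threshold `c j` makes it at most the one for `n`.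
  set c : ℕ → ℝ := fun j => ε / 2 * Real.sqrt (((2 ^ (j + 1) : ℕ) : ℝ) * d) with hc
  set Z : ℕ → Ω → ℝ := fun j ω =>
    (∑ i ∈ Finset.range (2 ^ (j + 1)), {ω | c j < newBlockSize M i ω}.indicator 1 ω) / 2 ^ j with hZ
  have hms : ∀ j i, MeasurableSet {ω | c j < newBlockSize M i ω} := fun j i =>
    measurableSet_lt measurable_const (measurable_newBlockSize hM i)
  have hind : ∀ j i, Integrable ({ω | c j < newBlockSize M i ω}.indicator (1 : Ω → ℝ)) P :=
    fun j i => (integrable_const (1 : ℝ)).indicator (hms j i)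
  have hZint : ∀ j, Integrable (Z j) P := fun j =>
    (integrable_finsetSum _ fun i _ => hind j i).div_const _
  have hZnonneg : ∀ j ω, 0 ≤ Z j ω := fun j ω =>
    div_nonneg (Finset.sum_nonneg fun i _ => Set.indicator_nonneg (fun _ _ => zero_le_one) _)
      (by positivity)
  have hpow : Tendsto (fun j : ℕ => 2 ^ (j + 1)) atTop atTop :=
    (tendsto_pow_atTop_atTop_of_one_lt (one_lt_two (α := ℕ))).comp (tendsto_add_atTop_nat 1)
  obtain ⟨J, hJ⟩ := eventually_atTop.1
    (hpow.eventually (hB.eventually_sum_measureReal_le hM hd hdiag (half_pos hε)))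
  have hZle : ∀ j, ∫ ω, Z (j + J) ω ∂P ≤ (1 / 2) ^ j := by
    intro j
    simp only [hZ]
    rw [integral_div, integral_finsetSum _ fun i _ => hind _ i]
    simp only [integral_indicator_one (hms _ _)]
    have h1 := hJ (j + J) (by omega)
    rw [div_le_iff₀ (by positivity)]
    refine h1.trans ?_
    rw [pow_add, ← mul_assoc, ← mul_pow]
    norm_num
    exact one_le_pow₀ one_le_two
  have hae := ae_tendsto_zero_of_summable_integral (fun j ω => hZnonneg (j + J) ω)
    (fun j => hZint (j + J)) (summable_geometric_of_lt_one (by norm_num) (by norm_num)) hZle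
  filter_upwards [hae] with ω hω
  rw [tendsto_add_atTop_iff_nat (f := fun j => Z j ω)] at hω
  have hlog : Tendsto (Nat.log 2) atTop atTop :=
    tendsto_atTop.2 fun b => by
      filter_upwards [eventually_ge_atTop (2 ^ b)] with n hn
      exact Nat.le_log_of_pow_le one_lt_two hn
  refine squeeze_zero' (Eventually.of_forall fun n => by positivity) ?_ (hω.comp hlog)
  filter_upwards [eventually_ge_atTop 1] with n hn
  set j := Nat.log 2 n with hj
  have hjn : 2 ^ j ≤ n := Nat.pow_log_le_self 2 (by omega)
  have hnj : n < 2 ^ (j + 1) := Nat.lt_pow_succ_log_self one_lt_two n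
  have hcj : c j ≤ ε * Real.sqrt ((n : ℝ) * d) := by
    have h1 : Real.sqrt (((2 ^ (j + 1) : ℕ) : ℝ) * d) ≤ 2 * Real.sqrt ((n : ℝ) * d) := by
      rw [← Real.sqrt_sq (zero_le_two (α := ℝ)), ← Real.sqrt_mul (by norm_num)]
      refine Real.sqrt_le_sqrt ?_
      have h2 : ((2 ^ (j + 1) : ℕ) : ℝ) ≤ 2 ^ 2 * n := by
        have : 2 ^ (j + 1) ≤ 2 ^ 2 * n := by rw [pow_succ]; omega
        exact_mod_cast this
      rw [← mul_assoc]
      exact mul_le_mul_of_nonneg_right h2 d.cast_nonneg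
    simp only [hc]
    nlinarith
  have hcard : ((badBlocks (M n ω) (ε * Real.sqrt ((n : ℝ) * d))).card : ℝ) ≤
      ∑ i ∈ Finset.range (2 ^ (j + 1)), {ω | c j < newBlockSize M i ω}.indicator 1 ω := by
    simp only [Set.indicator_apply, Set.mem_ofPred_eq, Pi.one_apply, ← Finset.sum_filter,
      Finset.sum_const, nsmul_eq_mul, mul_one, Nat.cast_le]
    refine Finset.card_le_card_of_injOn (fun i => (i : ℕ)) (fun i hi => ?_)
      (Fin.val_injective.injOn)
    have hi' := (Finset.mem_filter.1 hi).2
    rw [hB.diagBlockSize_eq] at hi'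
    simp only [Finset.coe_filter, Finset.mem_range, Set.mem_ofPred_eq]
    exact ⟨i.2.trans hnj, hcj.trans_lt hi'⟩
  simp only [Function.comp_apply, hZ]
  exact div_le_div₀ ((Nat.cast_nonneg _).trans hcard) hcard (by positivity)
    (by exact_mod_cast hjn)

/-- Almost surely, the diagonal part has few large blocks at every scale `1 / (m + 1)`, so that the
deterministic convergence theorem applies. -/
theorem IsBlockModel.ae_tendsto_integral (hM : IsBlockModel P ν M) (hν : IsOrthogonalLaw ν)
    (hd : 1 ≤ d)
    (hdiag : TendstoInMeasure P (fun n ω => opNorm (blockDiagPart (M n ω)) /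
      Real.sqrt ((n : ℝ) * d)) atTop (fun _ => (0 : ℝ))) (hB : IsBordered P M) :
    ∀ᵐ ω ∂P, ∀ f : BoundedContinuousFunction ℝ ℝ,
      Tendsto (fun n => ∫ x, f x ∂spectralDistribution
        (isHermitian_smul (hM.isHermitian n ω) (1 / Real.sqrt ((n : ℝ) * d)))) atTop
        (𝓝 (∫ x, f x ∂scaledSemicircle (1 / Real.sqrt d))) := by
  filter_upwards [hM.ae_tendsto_trace_aeval hν hd, ae_all_iff.2 fun m : ℕ =>
    hB.ae_tendsto_card_badBlocks hM.measurable hd hdiag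
      (ε := 1 / ((m : ℝ) + 1)) (by positivity)] with ω hmom hbad
  refine tendsto_integral_spectralDistribution hd (fun n => hM.isHermitian n ω) hmom le_rfl ?_
  intro ε hε
  obtain ⟨m, hm⟩ := exists_nat_one_div_lt hε
  refine squeeze_zero (fun n => by positivity) (fun n => ?_) (hbad m)
  have hsub : badBlocks (M n ω) (ε * Real.sqrt ((n : ℝ) * d)) ⊆
      badBlocks (M n ω) (1 / ((m : ℝ) + 1) * Real.sqrt ((n : ℝ) * d)) := by
    refine Finset.monotone_filter_right _ fun i _ hi => lt_of_le_of_lt ?_ hi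
    exact mul_le_mul_of_nonneg_right hm.le (Real.sqrt_nonneg _)
  exact div_le_div_of_nonneg_right (by exact_mod_cast Finset.card_le_card hsub) n.cast_nonneg

end Bordered

end HaarBlocks

theorem mainTheorem8 {Ω : Type*} [MeasurableSpace Ω] (P : Measure Ω) [IsProbabilityMeasure P]
    (d : ℕ) (ν : Measure (Matrix (Fin d) (Fin d) ℝ))
    (hν : (1 ≤ d ∧ ν = HaarBlocks.haarO d) ∨ (2 ≤ d ∧ ν = HaarBlocks.haarSO d)) :
    (∀ B : Ω → Matrix (Fin d) (Fin d) ℝ, HasLaw B ν P →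
      (∀ i j, ∫ ω, B ω i j ∂P = 0) ∧
      HaarBlocks.HasSimpleStructure (1 / Real.sqrt d) B P) ∧
    (∀ (M : (n : ℕ) → Ω → Matrix (Fin n × Fin d) (Fin n × Fin d) ℝ)
      (hM : HaarBlocks.IsBlockModel P ν M),
      TendstoInMeasure P
        (fun n ω => HaarBlocks.opNorm (HaarBlocks.blockDiagPart (M n ω)) /
          Real.sqrt ((n : ℝ) * d)) atTop (fun _ => (0 : ℝ)) →
      (∀ f : BoundedContinuousFunction ℝ ℝ,
        TendstoInMeasure P
          (fun n ω => ∫ x, f x ∂HaarBlocks.spectralDistribution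
            (HaarBlocks.isHermitian_smul (hM.isHermitian n ω) (1 / Real.sqrt ((n : ℝ) * d))))
          atTop
          (fun _ => ∫ x, f x ∂HaarBlocks.scaledSemicircle (1 / Real.sqrt d))) ∧
      (HaarBlocks.IsBordered P M →
        ∀ᵐ ω ∂P, ∀ f : BoundedContinuousFunction ℝ ℝ,
          Tendsto
            (fun n => ∫ x, f x ∂HaarBlocks.spectralDistribution
              (HaarBlocks.isHermitian_smul (hM.isHermitian n ω) (1 / Real.sqrt ((n : ℝ) * d))))
            atTop
            (𝓝 (∫ x, f x ∂HaarBlocks.scaledSemicircle (1 / Real.sqrt d))))) := by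
  obtain ⟨hd, hlaw⟩ : 1 ≤ d ∧ HaarBlocks.IsOrthogonalLaw ν := by
    rcases hν with ⟨hd, rfl⟩ | ⟨hd, rfl⟩
    · exact ⟨hd, HaarBlocks.isOrthogonalLaw_haarO d⟩
    · exact ⟨by omega, HaarBlocks.isOrthogonalLaw_haarSO hd⟩
  exact ⟨fun B hB => ⟨hlaw.integral_entry_eq_zero hB, hlaw.hasSimpleStructure hd hB⟩,
    fun M hM hdiag => ⟨hM.tendstoInMeasure_integral hlaw hd hdiag,
      hM.ae_tendsto_integral hlaw hd hdiag⟩⟩
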